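/- **Setting.** For a simple graph $X$ with adjacency matrix $A$ let $U(t)=e^{itA}$. For distinct vertices $u,v$: perfect state transfer (PST) occurs between $u$ and $v$ if $|U(\tau)_{u,v}|=1$ for some $\tau$; pretty good state transfer (PGST) occurs if $|U(\tau_k)_{u,v}|\to 1$ for some sequence $\tau_k\to\infty$. For $0<C\le 1$, $u$ is $C$-sedentary if $\inf_{t>0}|U(t)_{u,u}|\ge C$; sharply $C$-sedentary if this infimum equals $C$; tightly $C$-sedentary at time $t_0>0$ if moreover the infimum $C$ is attained at $t_0$. It is sedentary (tightly sedentary) if it is $C$-sedentary (tightly $C$-sedentary at some time) for some $C\in(0,1]$, and not sedentary if the infimum is $0$. Vertices $u\ne v$ are twins if $N(u)\setminus\{u,v\}=N(v)\setminus\{u,v\}$. The eigenvalue support $\sigma_u(A)$ is the set of eigenvalues $\lambda$ of $A$ such that the orthogonal projection of $e_u$ onto the $\lambda$-eigenspace is nonzero. $\nu_2(a)$ is the exponent of $2$ in the integer $a$, with $\nu_2(0)=\infty$. **Theorem.** Let $X=K_{n_1,\ldots,n_k}$ be a complete multipartite graph with $k\ge 2$ and all $n_j\ge1$, let $n=\sum_j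 n_j$, and let $A=A(X)$. 1. Let $\varnothing\ne\mathcal I\subseteq\{1,\ldots,k\}$ with $n_\ell=1$ for every $\ell\in\mathcal I$. (a) Let $|\mathcal I|=1$ and $n_r=m$ for all $r\notin\mathcal I$, let $u$ be the vertex of the part in $\mathcal I$, and put $D=(n-m-1)^2+4(n-1)$. Then $|U(t)_{u,u}|^2\ge \frac{(n-m-1)^2}{D}$ for all $t$, with equality at $t=\frac{j\pi}{\sqrt D}$ for every odd integer $j$. In particular, if $n>m+1$, then $u$ is $\frac{(n-m-1)^2}{D}$-sedentary, and it is tightly $\frac{n-m-1}{\sqrt D}$-sedentary at each time $t=\frac{j\pi}{\sqrt D}$ with $j>0$ odd. (b) Let $|\mathcal I|=2$, $k\ge3$ and $n_r=m$ for all $r\notin\mathcal I$. Let $\Delta=(n-m-3)^2+8(n-2)$. (i) If $\Delta$ is not a perfect square, then PGST occurs between the two vertices of the parts in $\mathcal I$. (ii) If $\Delta$ is a perfect square and $\nu_2(n-m+1)\ne\nu_2(\sqrt\Delta)$, then PST occurs between these two vertices. (iii) If $\Delta$ is a perfect square and $\nu_2(n-m+1)=\nu_2(\sqrt\Delta)$,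 then each of these two vertices is tightly sedentary. (c) Let $|\mathcal I|\ge3$ and let $u$ be the vertex of a part in $\mathcal I$. Then $|U(t)_{u,u}|\ge 1-\frac2{|\mathcal I|}$ for all $t$. If moreover $\mathcal I\neq\{1,\ldots,k\}$ and $n_r=m$ for all $r\notin\mathcal I$, let $\Delta=(n-m-2|\mathcal I|+1)^2+4|\mathcal I|(n-|\mathcal I|)$. (i) Let $\Delta$ be a perfect square. If $\nu_2(n-m+1)\ne\nu_2(\sqrt\Delta)$, then $u$ is tightly $(1-\frac2{|\mathcal I|})$-sedentary at time $t=\frac{2j\pi}{g}$ for every odd $j>0$, where $g=\gcd(n-m+1+\sqrt\Delta,\,n-m+1-\sqrt\Delta)$. Otherwise $u$ is tightly $C$-sedentary for some $C>1-\frac2{|\mathcal I|}$. (ii) If $\Delta$ is not a perfect square, then $u$ is sharply $(1-\frac2{|\mathcal I|})$-sedentary. (d) Let $|\mathcal I|\le n-4$ and $n_r=2$ for all $r\notin\mathcal I$. Let $\Delta=(n-1)^2+4|\mathcal I|$. (i) If $\Delta$ is not a perfect square, then, for every part of size two, PGST occurs between its two vertices if and only if $n\equiv3\pmod 4$. (ii)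 If $\Delta$ is a perfect square, then, for every part of size two, PST occurs between its two vertices if and only if $\nu_2(n-3)\ne\nu_2(\sqrt\Delta)$. (iii) If either $\Delta$ is not a perfect square and $n\not\equiv3\pmod4$, or $\Delta$ is a perfect square and $\nu_2(n-3)=\nu_2(\sqrt\Delta)$, then each vertex in a part of size two is sedentary. 2. Let $u$ be a vertex of a part of size $n_\ell=2$, let $v$ be a twin of $u$, and let $n_r=m$ for all $r\ne\ell$. Let $\Delta=(n-m-2)^2+8(n-2)$. (a) If (i) $\Delta$ is not a perfect square, or (ii) $\Delta$ is a perfect square and $\nu_2(n-m-2)\ne\nu_2(\sqrt\Delta)$, or (iii) $n=m+2$, then $u$ is not sedentary. In case (i) PGST occurs between $u$ and $v$; in cases (ii) and (iii) PST occurs between them. (b) Let $n>m+2$ and $n-2=\frac12 s(n-m-2+s)$ for some integer $s$ with $\nu_2(n-m-2)\le\nu_2(s)$. Let $g=\gcd(n-m-2,s)$, $d_1=(n-m-2)/g$ and $s_1=s/g$. (i) If $s_1=1$, then $|U(t)_{u,u}|\ge\frac1{d_1+2}$ for all $t$, with equality if and only if $t=\frac{j\pi}g$ for some odd integer $j$.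 (ii) If $s_1\ge2$, then $|U(t)_{u,u}|\ge\frac{\sqrt2}{d_1+2s_1}$ for all $t$, with equality if and only if $t=\frac{j\pi}g$ for some odd integer $j$. 3. Let $u$ be a vertex of a part of size $n_\ell\ge3$. Then $|U(t)_{u,u}|\ge1-\frac2{n_\ell}$ for all $t$. If $n_r=m$ for all $r\ne\ell$, $\Delta=(n-n_\ell-m)^2+4n_\ell(n-n_\ell)$ is a perfect square and $\nu_2(n-n_\ell-m)\ne\nu_2(\sqrt\Delta)$, then $u$ is tightly $(1-\frac2{n_\ell})$-sedentary at time $t=\frac{2j\pi}g$ for every odd $j>0$, where $g=\gcd(n-n_\ell-m+\sqrt\Delta,\,n-n_\ell-m-\sqrt\Delta)$. Furthermore, if the nonzero elements of $\sigma_u(A)$ are linearly independent over $\mathbb Q$, then $u$ is sharply $(1-\frac2{n_\ell})$-sedentary. -/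

import Mathlib

noncomputable section

namespace QuantumWalk

variable {V : Type*} [Fintype V] [DecidableEq V]

/-- The transition matrix `U_A(t) = exp(i t A)` of the continuous-time quantum walk on the simple
graph `G` with respect to its adjacency matrix `A`. -/
def transition (G : SimpleGraph V) [DecidableRel G.Adj] (t : ℝ) : Matrix V V ℂ :=
  NormedSpace.exp ((Complex.I * (t : ℂ)) • G.adjMatrix ℂ)

/-- Perfect state transfer occurs between `u` and `v` (at some time). -/
def HasPST (G : SimpleGraph V) [DecidableRel G.Adj] (u v : V) : Prop :=
  ∃ τ : ℝ, ‖transition G τ u v‖ = 1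

/-- Pretty good state transfer occurs between `u` and `v`: along some sequence of times tending to
infinity, the modulus of the `(u, v)` entry of the transition matrix tends to `1`. -/
def HasPGST (G : SimpleGraph V) [DecidableRel G.Adj] (u v : V) : Prop :=
  ∃ τ : ℕ → ℝ, Filter.Tendsto τ Filter.atTop Filter.atTop ∧
    Filter.Tendsto (fun k => ‖transition G (τ k) u v‖) Filter.atTop (nhds 1)

/-- `inf_{t > 0} |U_A(t)_{u,u}|` (an infimum of a nonempty set of nonnegative reals). -/
def returnInf (G : SimpleGraph V) [DecidableRel G.Adj] (u : V) : ℝ :=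
  ⨅ t : Set.Ioi (0 : ℝ), ‖transition G (t : ℝ) u u‖

/-- The vertex `u` is `C`-sedentary. -/
def IsCSedentary (G : SimpleGraph V) [DecidableRel G.Adj] (u : V) (C : ℝ) : Prop :=
  0 < C ∧ C ≤ 1 ∧ C ≤ returnInf G u

/-- The vertex `u` is sedentary. -/
def IsSedentary (G : SimpleGraph V) [DecidableRel G.Adj] (u : V) : Prop :=
  ∃ C : ℝ, IsCSedentary G u C

/-- The vertex `u` is not sedentary: the infimum is zero. -/
def IsNotSedentary (G : SimpleGraph V) [DecidableRel G.Adj] (u : V) : Prop :=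
  returnInf G u = 0

/-- The vertex `u` is sharply `C`-sedentary: the infimum equals `C`. -/
def IsSharplySedentary (G : SimpleGraph V) [DecidableRel G.Adj] (u : V) (C : ℝ) : Prop :=
  IsCSedentary G u C ∧ returnInf G u = C

/-- The vertex `u` is tightly `C`-sedentary at time `t₀`: the infimum equals `C` and it is attained
at the time `t₀ > 0`. -/
def IsTightlySedentaryAt (G : SimpleGraph V) [DecidableRel G.Adj] (u : V) (C t₀ : ℝ) : Prop :=
  IsCSedentary G u C ∧ returnInf G u = C ∧ 0 < t₀ ∧ ‖transition G t₀ u u‖ = C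

/-- The vertex `u` is tightly `C`-sedentary (at some time). -/
def IsTightlySedentary (G : SimpleGraph V) [DecidableRel G.Adj] (u : V) (C : ℝ) : Prop :=
  ∃ t₀ : ℝ, IsTightlySedentaryAt G u C t₀

/-- Twins in a simple unweighted graph; they may or may not be adjacent. -/
def IsTwin (G : SimpleGraph V) (u v : V) : Prop :=
  u ≠ v ∧ G.neighborSet u \ {u, v} = G.neighborSet v \ {u, v}

/-- The eigenvalue support `σ_u(A)`: those real `lam` for which the orthogonal projection of the
standard basis vector `e_u` onto the eigenspace of the adjacency matrix at `lam` is nonzero. (When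
`lam` is not an eigenvalue this eigenspace is zero, so `lam` is not in the support.) -/
def eigenvalueSupport (G : SimpleGraph V) [DecidableRel G.Adj] (u : V) : Set ℝ :=
  {lam : ℝ |
    (Module.End.eigenspace (Matrix.toEuclideanLin (G.adjMatrix ℝ)) lam).starProjection
      (EuclideanSpace.single u (1 : ℝ)) ≠ 0}

/-- The exponent of the largest power of two dividing the integer `a` (infinite for `a = 0`). -/
def nu2 (a : ℤ) : ℕ∞ := emultiplicity 2 a

/-- The complete multipartite graph with part sizes `N 0, …, N (k - 1)`: the vertex `⟨ℓ, x⟩` lies in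
part `ℓ`, and two vertices are adjacent if and only if they lie in different parts. -/
abbrev multipartite {k : ℕ} (N : Fin k → ℕ) : SimpleGraph (Σ ℓ : Fin k, Fin (N ℓ)) :=
  SimpleGraph.completeMultipartiteGraph fun ℓ => Fin (N ℓ)

end QuantumWalk

end

/-!
If the basis vector `e_u` is written as a sum of eigenvectors `y_j` of the adjacency matrix, with
eigenvalues `λ_j`, then `U(t)_{v,u} = ∑ j, exp(i t λ_j) y_j(v)`; in particular `U(t)_{u,u}` is a convex
combination of phases. Everything is read off from such decompositions.

For a set `T` of `a` pairwise twins joined to all other vertices, `e_u - (1/a) 1_T` is an eigenvector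
(eigenvalue `-1` if `T` is a clique, `0` if it is independent), so one phase has weight at least
`1 - 1/a` and `|U(t)_{u,u}| ≥ 1 - 2/a` (`IsTwinSet.le_norm_transition`). If moreover the graph outside
`T` is regular, `1_T` splits into two eigenvectors of the quotient by `{T, Tᶜ}`, and up to a global
phase `U(t)_{u,u} = 1 - 1/a + (1/a) (p exp(i t μ₊) + (1 - p) exp(i t μ₋))` with `0 < p < 1` and
`μ± = (b ± √Δ) / 2` (`IsTwinSet.transition_apply`, `IsTwoPhaseWalk`). The bound `1 - 2/a` is attained
exactly when both phases are `-1`, and approached exactly when both come close to `-1`; for `a = 2`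
these are perfect and pretty good state transfer. Which of them happens is arithmetic:

* if `Δ` is a square, `μ±` are integers with sum `b` and difference `√Δ`, and both phases can be `-1`
  at once if and only if `μ±` have the same 2-adic valuation, that is, `ν₂(b) ≠ ν₂(√Δ)`
  (`phase_eq_neg_one_of_nu2_ne`, `nu2_ne_of_phase_eq_neg_one`); otherwise periodicity makes the
  minimum of `|U(t)_{u,u}|` attained and larger than `1 - 2/a`;
* if `Δ` is not a square and `b ≠ 0`, then `μ±` are linearly independent over `ℚ`, and Kronecker's
  approximation theorem (`exists_forall_phase_near_neg_one`) brings both phases close to `-1` at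
  arbitrarily late times.

When singletons are combined with parts of size two, the phase of the eigenvalue `-2` occurs as well,
and the relation `λ₊ + λ₋ = n - 3` lets the three phases approach `-1` if and only if
`n ≡ 3 (mod 4)` (`hasPGST_pair`, `not_hasPGST_pair`). The discriminant `(n - 1) ^ 2 + 4 |I|` is never
a square when `1 ≤ |I| ≤ n - 4` (`discr_ne_sq`), so only the non-square case occurs there.

The periodic walk on a part of size two reduces to a trigonometric inequality (`sin_sq_inequality`)
for `s₁ = 1`; counting vertices shows that a root `s ≥ 2` divides `n - m - 2` (`dvd_of_root`), so
that `s₁ = 1` is the only positive value of `s₁` that occurs.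

For a part of size at least three among arbitrary parts, the kernel of the adjacency matrix is
orthogonal to the indicator of the part, so that the eigenvalue `0` has weight exactly `1 - 1/a`, and
Kronecker's theorem applies to the other eigenvalues.
-/

set_option linter.unusedSectionVars false

open Complex Filter Topology

namespace QuantumWalk

/-! ### Phases and Kronecker's approximation theorem -/

section

/-- The phase `exp(i x)` of a real angle `x`. -/
noncomputable def phase (x : ℝ) : ℂ := cexp (I * x)

theorem phase_zero : phase 0 = 1 := by simp [phase]

theorem phase_add (x y : ℝ) : phase (x + y) = phase x * phase y := by
  simp only [phase, ofReal_add, mul_add, Complex.exp_add]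

theorem phase_eq_cos_add_sin (x : ℝ) : phase x = Real.cos x + Real.sin x * I := by
  rw [phase, mul_comm, Complex.exp_mul_I, ofReal_cos, ofReal_sin]

theorem phase_re (x : ℝ) : (phase x).re = Real.cos x := by
  rw [phase, mul_comm, exp_ofReal_mul_I_re]

theorem phase_im (x : ℝ) : (phase x).im = Real.sin x := by
  rw [phase, mul_comm, exp_ofReal_mul_I_im]

theorem norm_phase (x : ℝ) : ‖phase x‖ = 1 := by
  rw [phase, mul_comm]; exact norm_exp_ofReal_mul_I x

@[fun_prop]
theorem continuous_phase : Continuous phase := by unfold phase; fun_prop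

theorem phase_eq_neg_one_iff (x : ℝ) : phase x = -1 ↔ ∃ j : ℤ, Odd j ∧ x = j * Real.pi := by
  constructor
  · intro h
    have hc : Real.cos (x - Real.pi) = 1 := by
      have := congrArg Complex.re h
      rw [phase_re] at this
      rw [Real.cos_sub_pi, this]; simp
    obtain ⟨k, hk⟩ := (Real.cos_eq_one_iff _).1 hc
    exact ⟨2 * k + 1, odd_two_mul_add_one k, by push_cast; linarith⟩
  · rintro ⟨j, ⟨k, rfl⟩, rfl⟩
    have : Real.cos ((2 * k + 1 : ℤ) * Real.pi) = -1 ∧ Real.sin ((2 * k + 1 : ℤ) * Real.pi) = 0 := by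
      refine ⟨?_, Real.sin_int_mul_pi _⟩
      rw [show ((2 * k + 1 : ℤ) : ℝ) * Real.pi = Real.pi + k * (2 * Real.pi) by push_cast; ring,
        Real.cos_add_int_mul_two_pi, Real.cos_pi]
    rw [phase_eq_cos_add_sin, this.1, this.2]; simp

theorem phase_add_int_mul_two_pi (x : ℝ) (k : ℤ) : phase (x + k * (2 * Real.pi)) = phase x := by
  rw [phase_eq_cos_add_sin, phase_eq_cos_add_sin, Real.cos_add_int_mul_two_pi,
    Real.sin_add_int_mul_two_pi]

/-- The mean of `t ↦ exp(i ω t)` over a long interval tends to `0`, unless `ω = 0`. -/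
theorem tendsto_mean_exp (ω a : ℝ) :
    Tendsto (fun T : ℝ => (T : ℂ)⁻¹ * ∫ t in a..(a + T), cexp (I * ω * t)) atTop
      (𝓝 (if ω = 0 then 1 else 0)) := by
  split_ifs with h
  · subst h
    refine tendsto_const_nhds.congr' ?_
    filter_upwards [eventually_gt_atTop 0] with T hT
    have : (T : ℂ) ≠ 0 := by exact_mod_cast hT.ne'
    simp [this]
  · have hc : (I * ω : ℂ) ≠ 0 := by simp [h]
    have hn : ∀ x : ℝ, ‖cexp (I * ω * x)‖ = 1 := by
      intro x
      rw [show (I * ω * x : ℂ) = ((ω * x : ℝ) : ℂ) * I by push_cast; ring]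
      exact norm_exp_ofReal_mul_I _
    rw [tendsto_zero_iff_norm_tendsto_zero]
    have hb : ∀ᶠ T : ℝ in atTop,
        ‖(T : ℂ)⁻¹ * ∫ t in a..(a + T), cexp (I * ω * t)‖ ≤ T⁻¹ * (2 / |ω|) := by
      filter_upwards [eventually_gt_atTop 0] with T hT
      rw [norm_mul, norm_inv, norm_real, Real.norm_of_nonneg hT.le, integral_exp_mul_complex hc,
        norm_div]
      have h1 : ‖(I * ω : ℂ)‖ = |ω| := by simp
      rw [h1]
      gcongr
      refine (norm_sub_le _ _).trans ?_
      rw [hn, hn]; norm_num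
    have h0 : Tendsto (fun T : ℝ => T⁻¹ * (2 / |ω|)) atTop (𝓝 0) := by
      simpa using tendsto_inv_atTop_zero.mul_const (2 / |ω|)
    exact squeeze_zero' (Eventually.of_forall fun _ => norm_nonneg _) hb h0

theorem tendsto_mean_sum_exp {σ : Type*} (S : Finset σ) (c : σ → ℂ) (ω : σ → ℝ) (a : ℝ) :
    Tendsto (fun T : ℝ => (T : ℂ)⁻¹ * ∫ t in a..(a + T), ∑ s ∈ S, c s * cexp (I * ω s * t)) atTop
      (𝓝 (∑ s ∈ S, if ω s = 0 then c s else 0)) := by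
  have h : ∀ T : ℝ, (T : ℂ)⁻¹ * ∫ t in a..(a + T), ∑ s ∈ S, c s * cexp (I * ω s * t)
      = ∑ s ∈ S, c s * ((T : ℂ)⁻¹ * ∫ t in a..(a + T), cexp (I * ω s * t)) := by
    intro T
    rw [intervalIntegral.integral_finsetSum, Finset.mul_sum]
    · refine Finset.sum_congr rfl fun s _ => ?_
      rw [intervalIntegral.integral_const_mul]; ring
    · intro s _
      exact (Continuous.intervalIntegrable (by fun_prop) _ _)
  simp_rw [h]
  refine tendsto_finsetSum _ fun s _ => ?_
  have := (tendsto_mean_exp (ω s) a).const_mul (c s)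
  simpa using this

/-- Fourier expansion of `((1 - cos x) / 2) ^ p = sin (x / 2) ^ (2 p)`. -/
theorem half_one_sub_cos_pow (p : ℕ) (x : ℝ) :
    (((1 - Real.cos x) / 2 : ℝ) : ℂ) ^ p = ∑ m ∈ Finset.range (2 * p + 1),
      ((-1 / 4) ^ p * (-1) ^ m * ((2 * p).choose m : ℂ)) * cexp (I * (((m : ℝ) - p) * x : ℝ)) := by
  have h1 : (((1 - Real.cos x) / 2 : ℝ) : ℂ)
      = (-1 / 4) * (cexp (-(I * x)) * (-cexp (I * x) + 1) ^ 2) := by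
    push_cast
    rw [Complex.cos]
    have h2 : cexp (-(I * x)) * cexp (I * x) = 1 := by rw [← Complex.exp_add]; simp
    have h3 : cexp (x * I) = cexp (I * x) := by rw [mul_comm]
    have h4 : cexp (-x * I) = cexp (-(I * x)) := by ring_nf
    rw [h3, h4]
    linear_combination (-(1 / 2) + cexp (I * x) / 4) * h2
  rw [h1, mul_pow, mul_pow, ← pow_mul, add_pow, Finset.mul_sum, Finset.mul_sum]
  refine Finset.sum_congr rfl fun m _ => ?_
  have h5 : cexp (I * (((m : ℝ) - p) * x : ℝ)) = cexp (-(I * x)) ^ p * cexp (I * x) ^ m := by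
    rw [← Complex.exp_nat_mul, ← Complex.exp_nat_mul, ← Complex.exp_add]
    congr 1; push_cast; ring
  rw [h5, neg_pow (cexp (I * x))]
  ring

theorem norm_phase_add_one_sq (x : ℝ) : ‖phase x + 1‖ ^ 2 = 2 + 2 * Real.cos x := by
  rw [← normSq_eq_norm_sq, normSq_apply]
  simp only [add_re, phase_re, one_re, add_im, phase_im, one_im, add_zero]
  nlinarith [Real.sin_sq_add_cos_sq x]

/-- A case of **Kronecker's approximation theorem**: for real numbers `lam i` linearly independent over
`ℚ`, there are arbitrarily late times at which all phases `exp(i t lam i)` are close to `-1`.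
The mean over `t` of `∏ i, ((1 - cos (lam i * t)) / 2) ^ p` is `(choose (2 p) p / 4 ^ p) ^ #ι`, because
independence leaves only the product of the constant Fourier coefficients. This decays polynomially
in `p`, whereas the mean would decay exponentially if some factor always stayed away from `1`. -/
theorem exists_forall_phase_near_neg_one {ι : Type*} [Fintype ι] (lam : ι → ℝ)
    (hlam : LinearIndependent ℚ lam) (T₀ : ℝ) {ε : ℝ} (hε : 0 < ε) :
    ∃ t > T₀, ∀ i, ‖phase (lam i * t) + 1‖ < ε := by
  classical
  by_contra! hcon
  set r : ℝ := 1 - ε ^ 2 / 4 with hr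
  have hX0 : ∀ i t, 0 ≤ (1 - Real.cos (lam i * t)) / 2 := fun i t => by
    linarith [Real.cos_le_one (lam i * t)]
  have hX1 : ∀ i t, (1 - Real.cos (lam i * t)) / 2 ≤ 1 := fun i t => by
    linarith [Real.neg_one_le_cos (lam i * t)]
  have hXr : ∀ t > T₀, ∃ i, (1 - Real.cos (lam i * t)) / 2 ≤ r := by
    intro t ht
    obtain ⟨i, hi⟩ := hcon t ht
    refine ⟨i, ?_⟩
    have := pow_le_pow_left₀ hε.le hi 2
    rw [norm_phase_add_one_sq] at this
    rw [hr]; linarith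
  have hr0 : 0 ≤ r := by
    obtain ⟨i, hi⟩ := hXr (T₀ + 1) (by linarith)
    exact (hX0 i _).trans hi
  have hr1 : r < 1 := by rw [hr]; nlinarith [sq_nonneg ε, pow_pos hε 2]
  -- the coefficients of the trigonometric polynomial `((1 - cos x) / 2) ^ p`
  let c : ℕ → ℕ → ℂ := fun p m => (-1 / 4) ^ p * (-1) ^ m * ((2 * p).choose m : ℂ)
  have hcp : ∀ p, c p p = ((((2 * p).choose p : ℝ) / 4 ^ p : ℝ) : ℂ) := by
    intro p
    simp only [c]
    rw [← mul_pow]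
    push_cast
    rw [show (-1 / 4 * -1 : ℂ) = 1 / 4 by norm_num, one_div, inv_pow]
    ring
  have hF : ∀ p : ℕ, ∀ t : ℝ, ∏ i, ((((1 - Real.cos (lam i * t)) / 2 : ℝ) : ℂ) ^ p)
      = ∑ f ∈ Fintype.piFinset (fun _ : ι => Finset.range (2 * p + 1)),
        (∏ i, c p (f i)) * cexp (I * (∑ i, ((f i : ℝ) - p) * lam i : ℝ) * t) := by
    intro p t
    simp_rw [half_one_sub_cos_pow]
    rw [Finset.prod_univ_sum]
    refine Finset.sum_congr rfl fun f _ => ?_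
    rw [Finset.prod_mul_distrib, ← Complex.exp_sum]
    congr 2
    push_cast
    rw [← Finset.mul_sum, mul_assoc, Finset.sum_mul]
    congr 1
    exact Finset.sum_congr rfl fun i _ => by ring
  have hind : ∀ p : ℕ, ∀ f : ι → ℕ, (∑ i, ((f i : ℝ) - p) * lam i = 0) ↔ f = fun _ => p := by
    intro p f
    constructor
    · intro h
      funext i
      have := Fintype.linearIndependent_iff.1 hlam (fun i => (f i : ℚ) - p) (by
        rw [← h]; refine Finset.sum_congr rfl fun i _ => ?_
        rw [Rat.smul_def]; push_cast; rfl) i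
      have h2 : (f i : ℚ) = p := by linarith
      exact_mod_cast h2
    · rintro rfl; simp
  have hlim : ∀ p : ℕ, (((2 * p).choose p : ℝ) / 4 ^ p) ^ Fintype.card ι ≤ r ^ p := by
    intro p
    have h := tendsto_mean_sum_exp (Fintype.piFinset (fun _ : ι => Finset.range (2 * p + 1)))
      (fun f => ∏ i, c p (f i)) (fun f => ∑ i, ((f i : ℝ) - p) * lam i) T₀
    simp_rw [hind] at h
    rw [Finset.sum_ite_eq' , if_pos (by simp [Fintype.mem_piFinset]; omega)] at h
    simp only [Finset.prod_const, Finset.card_univ, hcp] at h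
    have h2 := h.norm
    rw [norm_pow, norm_real, Real.norm_of_nonneg (by positivity)] at h2
    refine le_of_tendsto h2 ?_
    filter_upwards [eventually_gt_atTop 0] with T hT
    rw [norm_mul, norm_inv, norm_real, Real.norm_of_nonneg hT.le]
    have h3 := intervalIntegral.norm_integral_le_of_norm_le_const (a := T₀) (b := T₀ + T)
      (C := r ^ p) (f := fun t : ℝ => ∑ f ∈ Fintype.piFinset (fun _ : ι => Finset.range (2 * p + 1)),
        (∏ i, c p (f i)) * cexp (I * (∑ i, ((f i : ℝ) - p) * lam i : ℝ) * t)) (by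
        intro t ht
        rw [Set.uIoc_of_le (by linarith)] at ht
        rw [← hF, norm_prod]
        obtain ⟨i, hi⟩ := hXr t ht.1
        simp_rw [norm_pow, norm_real]
        rw [← Finset.mul_prod_erase _ _ (Finset.mem_univ i), Real.norm_of_nonneg (hX0 i t)]
        calc _ ≤ ((1 - Real.cos (lam i * t)) / 2) ^ p * 1 := by
              refine mul_le_mul_of_nonneg_left (Finset.prod_le_one (fun j _ => by positivity)
                fun j _ => ?_) (pow_nonneg (hX0 i t) _)
              rw [Real.norm_of_nonneg (hX0 j t)]
              exact pow_le_one₀ (hX0 j t) (hX1 j t)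
          _ ≤ r ^ p := by rw [mul_one]; exact pow_le_pow_left₀ (hX0 i t) hi p)
    rw [add_sub_cancel_left, abs_of_pos hT] at h3
    calc _ ≤ T⁻¹ * (r ^ p * T) := by gcongr
      _ = r ^ p := by field_simp
  -- exponential decay beats the polynomial lower bound of the central binomial coefficient
  have hlow : ∀ p : ℕ, 1 ≤ p → 1 ≤ 3 ^ Fintype.card ι * ((p : ℝ) ^ Fintype.card ι * r ^ p) := by
    intro p hp
    have h1 : (4 : ℝ) ^ p ≤ (2 * p + 1) * (2 * p).choose p := by
      have := Nat.four_pow_le_two_mul_add_one_mul_central_binom p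
      exact_mod_cast this
    have hp' : (1 : ℝ) ≤ p := by exact_mod_cast hp
    have h2 : 1 ≤ (3 * p : ℝ) * (((2 * p).choose p : ℝ) / 4 ^ p) := by
      rw [mul_div_assoc', le_div_iff₀ (by positivity), one_mul]
      refine h1.trans ?_
      gcongr
      linarith
    calc (1 : ℝ) ≤ ((3 * p : ℝ) * (((2 * p).choose p : ℝ) / 4 ^ p)) ^ Fintype.card ι :=
          one_le_pow₀ h2
      _ = (3 * p : ℝ) ^ Fintype.card ι * (((2 * p).choose p : ℝ) / 4 ^ p) ^ Fintype.card ι :=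
          mul_pow _ _ _
      _ ≤ (3 * p : ℝ) ^ Fintype.card ι * r ^ p := by gcongr; exact hlim p
      _ = _ := by rw [mul_pow]; ring
  have hz := (tendsto_pow_const_mul_const_pow_of_abs_lt_one (Fintype.card ι) (r := r)
    (by rwa [abs_of_nonneg hr0])).const_mul ((3 : ℝ) ^ Fintype.card ι)
  rw [mul_zero] at hz
  have hge : (1 : ℝ) ≤ 0 := by
    refine ge_of_tendsto hz ?_
    filter_upwards [eventually_ge_atTop 1] with p hp using hlow p hp
  linarith

end

/-! ### The transition matrix in terms of eigenvectors -/

section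

variable {V : Type*} [Fintype V] [DecidableEq V]

/-- `exp(i t A)` acts on an eigenvector of `A` by the phase of its eigenvalue. -/
theorem transition_mulVec (G : SimpleGraph V) [DecidableRel G.Adj] (t : ℝ) {lam : ℝ} {x : V → ℝ}
    (hx : (G.adjMatrix ℝ).mulVec x = lam • x) :
    (transition G t).mulVec (fun v => (x v : ℂ)) = fun v => phase (lam * t) * (x v : ℂ) := by
  let : NormedRing (Matrix V V ℂ) := Matrix.linftyOpNormedRing
  let : NormedAlgebra ℂ (Matrix V V ℂ) := Matrix.linftyOpNormedAlgebra
  set B : Matrix V V ℂ := (I * (t : ℂ)) • G.adjMatrix ℂ with hB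
  set z : V → ℂ := fun v => (x v : ℂ) with hz
  have hA : (G.adjMatrix ℂ).mulVec z = (lam : ℂ) • z := by
    funext v
    have h := congrFun hx v
    have h2 : (((G.adjMatrix ℝ).mulVec x v : ℝ) : ℂ) = ((lam • x) v : ℝ) := by rw [h]
    simp only [Matrix.mulVec, dotProduct, SimpleGraph.adjMatrix_apply, Pi.smul_apply, smul_eq_mul,
      ofReal_sum, ofReal_mul] at h2
    simp only [Matrix.mulVec, dotProduct, SimpleGraph.adjMatrix_apply, Pi.smul_apply, smul_eq_mul]
    rw [hz, ← h2]
    refine Finset.sum_congr rfl fun w _ => ?_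
    split_ifs <;> simp
  have hBz : B.mulVec z = (I * (lam * t : ℝ)) • z := by
    rw [hB, Matrix.smul_mulVec, hA, smul_smul]; push_cast; ring_nf
  have hpow : ∀ m : ℕ, (B ^ m).mulVec z = (I * (lam * t : ℝ)) ^ m • z := by
    intro m
    induction m with
    | zero => simp
    | succ m ih => rw [pow_succ, ← Matrix.mulVec_mulVec, hBz, Matrix.mulVec_smul, ih, smul_smul,
        pow_succ, mul_comm]
  have hs : HasSum (fun m : ℕ => ((m.factorial : ℂ)⁻¹) • B ^ m) (NormedSpace.exp B) :=
    NormedSpace.exp_series_hasSum_exp' (𝕂 := ℂ) B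
  let L : Matrix V V ℂ →ₗ[ℂ] (V → ℂ) :=
    { toFun := fun M => M.mulVec z
      map_add' := fun M N => Matrix.add_mulVec M N z
      map_smul' := fun c M => Matrix.smul_mulVec c M z }
  have hL : Continuous L := LinearMap.continuous_of_finiteDimensional L
  have h1 := hs.map L hL
  have h2 : HasSum (fun m : ℕ => ((m.factorial : ℂ)⁻¹) • (I * (lam * t : ℝ)) ^ m)
      (NormedSpace.exp (I * (lam * t : ℝ))) :=
    NormedSpace.exp_series_hasSum_exp' (𝕂 := ℂ) (I * ((lam * t : ℝ) : ℂ))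
  have h3 := h2.smul_const z
  have h4 : (L ∘ fun m : ℕ => ((m.factorial : ℂ)⁻¹) • B ^ m)
      = fun m : ℕ => (((m.factorial : ℂ)⁻¹) • (I * (lam * t : ℝ)) ^ m) • z := by
    funext m
    change (((m.factorial : ℂ)⁻¹) • B ^ m).mulVec z = _
    rw [Matrix.smul_mulVec, hpow, smul_assoc]
  rw [h4] at h1
  have h5 := h1.unique h3
  change (NormedSpace.exp B).mulVec z = _
  change (NormedSpace.exp B).mulVec z = _ at h5
  rw [h5, ← Complex.exp_eq_exp_ℂ]
  rfl

/-- A decomposition of `e_u` into eigenvectors `y j` with eigenvalues `lam j` determines the column of `u`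
of the transition matrix. -/
theorem transition_apply_of_eigenvectors (G : SimpleGraph V) [DecidableRel G.Adj] {ι : Type*}
    [Fintype ι] (lam : ι → ℝ) (y : ι → V → ℝ)
    (hy : ∀ j, (G.adjMatrix ℝ).mulVec (y j) = lam j • y j) {u : V}
    (hu : ∀ v, ∑ j, y j v = if v = u then 1 else 0) (t : ℝ) (v : V) :
    transition G t v u = ∑ j, phase (lam j * t) * (y j v : ℂ) := by
  have h1 : (Pi.single u 1 : V → ℂ) = ∑ j, fun w => (y j w : ℂ) := by
    funext w
    rw [Finset.sum_apply, ← ofReal_sum, hu, Pi.single_apply]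
    split_ifs <;> simp
  have h2 := congrFun (Matrix.mulVec_single_one (transition G t) u) v
  rw [h1, Matrix.mulVec_sum] at h2
  simp only [Finset.sum_apply, transition_mulVec G t (hy _)] at h2
  exact h2.symm

/-- An orthonormal basis of eigenvectors of the adjacency matrix, read off coordinatewise. -/
theorem exists_orthonormal_eigenvectors (G : SimpleGraph V) [DecidableRel G.Adj] :
    ∃ (lam : V → ℝ) (b : OrthonormalBasis V ℝ (EuclideanSpace ℝ V)),
      ∀ j, (G.adjMatrix ℝ).mulVec (b j) = lam j • (b j : V → ℝ) := by
  have hA : (G.adjMatrix ℝ).IsHermitian := by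
    rw [Matrix.IsHermitian, Matrix.conjTranspose_eq_transpose_of_trivial]
    exact G.isSymm_adjMatrix
  exact ⟨hA.eigenvalues, hA.eigenvectorBasis, hA.mulVec_eigenvectorBasis⟩

theorem sum_basis_apply_mul_apply (b : OrthonormalBasis V ℝ (EuclideanSpace ℝ V))
    (u v : V) : ∑ j, b j v * b j u = if v = u then 1 else 0 := by
  have h := b.sum_repr (EuclideanSpace.single u (1 : ℝ))
  have h2 := congrArg (fun x : EuclideanSpace ℝ V => x v) h
  simp only [b.repr_apply_apply, EuclideanSpace.inner_single_right] at h2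
  simpa [mul_comm, Pi.single_apply] using h2

/-- The return amplitude at `u` is a convex combination of phases; the weight of the eigenvector `b j` is
`(b j u) ^ 2`. -/
theorem transition_apply_spectral (G : SimpleGraph V) [DecidableRel G.Adj] {lam : V → ℝ}
    {b : OrthonormalBasis V ℝ (EuclideanSpace ℝ V)}
    (hb : ∀ j, (G.adjMatrix ℝ).mulVec (b j) = lam j • (b j : V → ℝ)) (t : ℝ) (u : V) :
    transition G t u u = ∑ j, phase (lam j * t) * ((b j u ^ 2 : ℝ) : ℂ) := by
  rw [transition_apply_of_eigenvectors G lam (fun j => b j u • (b j : V → ℝ)) (u := u)]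
  · refine Finset.sum_congr rfl fun j _ => ?_
    rw [Pi.smul_apply, smul_eq_mul, sq]
  · intro j
    rw [Matrix.mulVec_smul, hb, smul_comm]
  · intro v
    simp only [Pi.smul_apply, smul_eq_mul]
    rw [← sum_basis_apply_mul_apply b u v]
    exact Finset.sum_congr rfl fun j _ => mul_comm _ _

theorem sum_basis_apply_sq (b : OrthonormalBasis V ℝ (EuclideanSpace ℝ V)) (u : V) :
    ∑ j, b j u ^ 2 = 1 := by
  simpa [sq] using sum_basis_apply_mul_apply b u u

theorem norm_transition_self_le_one (G : SimpleGraph V) [DecidableRel G.Adj] (t : ℝ) (u : V) :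
    ‖transition G t u u‖ ≤ 1 := by
  obtain ⟨lam, b, hb⟩ := exists_orthonormal_eigenvectors G
  rw [transition_apply_spectral G hb, ← sum_basis_apply_sq b u]
  refine (norm_sum_le _ _).trans (Finset.sum_le_sum fun j _ => ?_)
  rw [norm_mul, norm_phase, one_mul, norm_real, Real.norm_of_nonneg (sq_nonneg _)]

theorem continuous_norm_transition_self (G : SimpleGraph V) [DecidableRel G.Adj] (u : V) :
    Continuous fun t => ‖transition G t u u‖ := by
  obtain ⟨lam, b, hb⟩ := exists_orthonormal_eigenvectors G
  simp_rw [transition_apply_spectral G hb]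
  fun_prop

section Sedentary

variable {G : SimpleGraph V} [DecidableRel G.Adj] {u : V} {C : ℝ}

theorem returnInf_le {t : ℝ} (ht : 0 < t) : returnInf G u ≤ ‖transition G t u u‖ :=
  ciInf_le (f := fun t : Set.Ioi (0 : ℝ) => ‖transition G (t : ℝ) u u‖)
    ⟨0, by rintro _ ⟨s, rfl⟩; exact norm_nonneg _⟩ ⟨t, ht⟩

theorem le_returnInf (h : ∀ t, 0 < t → C ≤ ‖transition G t u u‖) : C ≤ returnInf G u :=
  haveI : Nonempty (Set.Ioi (0 : ℝ)) := ⟨⟨1, Set.mem_Ioi.2 one_pos⟩⟩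
  le_ciInf fun t => h t t.2

theorem isCSedentary_of_forall_le (hC : 0 < C) (h : ∀ t, C ≤ ‖transition G t u u‖) :
    IsCSedentary G u C :=
  ⟨hC, (h 0).trans (norm_transition_self_le_one G 0 u), le_returnInf fun t _ => h t⟩

theorem isTightlySedentaryAt_of_forall_le (hC : 0 < C) (h : ∀ t, C ≤ ‖transition G t u u‖)
    {t₀ : ℝ} (ht₀ : 0 < t₀) (h₀ : ‖transition G t₀ u u‖ = C) : IsTightlySedentaryAt G u C t₀ :=
  ⟨isCSedentary_of_forall_le hC h,
    le_antisymm (h₀ ▸ returnInf_le ht₀) (le_returnInf fun t _ => h t), ht₀, h₀⟩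

theorem isSharplySedentary_of_forall_le (hC : 0 < C) (h : ∀ t, C ≤ ‖transition G t u u‖)
    (h' : ∀ ε > 0, ∃ t > 0, ‖transition G t u u‖ ≤ C + ε) : IsSharplySedentary G u C := by
  refine ⟨isCSedentary_of_forall_le hC h, le_antisymm ?_ (le_returnInf fun t _ => h t)⟩
  refine le_of_forall_pos_le_add fun ε hε => ?_
  obtain ⟨t, ht, hle⟩ := h' ε hε
  exact (returnInf_le ht).trans hle

theorem isNotSedentary_of_forall_exists (h : ∀ ε > 0, ∃ t > 0, ‖transition G t u u‖ ≤ ε) :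
    IsNotSedentary G u := by
  refine le_antisymm ?_ (le_returnInf fun t _ => norm_nonneg _)
  refine le_of_forall_pos_le_add fun ε hε => ?_
  obtain ⟨t, ht, hle⟩ := h ε hε
  rw [zero_add]
  exact (returnInf_le ht).trans hle

theorem exists_isTightlySedentary_of_periodic {c τ : ℝ} (hc : 0 ≤ c) (hτ : 0 < τ)
    (hper : Function.Periodic (fun t => ‖transition G t u u‖) τ)
    (h : ∀ t, c < ‖transition G t u u‖) : ∃ C, c < C ∧ IsTightlySedentary G u C := by
  obtain ⟨t₀, ht₀, hmin⟩ := (isCompact_Icc (a := τ) (b := τ + τ)).exists_isMinOn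
    (Set.nonempty_Icc.2 (by linarith)) (continuous_norm_transition_self G u).continuousOn
  refine ⟨‖transition G t₀ u u‖, h t₀, t₀,
    isTightlySedentaryAt_of_forall_le (hc.trans_lt (h t₀)) (fun t => ?_) (hτ.trans_le ht₀.1) rfl⟩
  obtain ⟨s, hs, hst⟩ := hper.exists_mem_Ico hτ t τ
  rw [show ‖transition G t u u‖ = ‖transition G s u u‖ from hst]
  exact hmin (Set.Ico_subset_Icc_self hs)

end Sedentary

end

/-! ### Twin sets -/

section

variable {V : Type*} [Fintype V] [DecidableEq V]

/-- `T` is a nonempty set of pairwise twins of `G` which is joined to every vertex outside `T`; it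
is a clique if `κ = 1` and an independent set if `κ = 0`. -/
structure IsTwinSet (G : SimpleGraph V) [DecidableRel G.Adj] (T : Finset V) (κ : ℝ) : Prop where
  nonempty : T.Nonempty
  adj : ∀ u ∈ T, ∀ v, G.adjMatrix ℝ v u = if v ∈ T then (if v = u then 0 else κ) else 1

/-- Every vertex outside `T` has exactly `ρ` neighbours outside `T`. -/
def IsRegularOutside (G : SimpleGraph V) [DecidableRel G.Adj] (T : Finset V) (ρ : ℝ) : Prop :=
  ∀ v ∉ T, ∑ w ∈ Tᶜ, G.adjMatrix ℝ v w = ρ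

variable {G : SimpleGraph V} [DecidableRel G.Adj] {T : Finset V} {κ ρ : ℝ}

theorem IsTwinSet.card_pos (hT : IsTwinSet G T κ) : 0 < (T.card : ℝ) := by
  exact_mod_cast hT.nonempty.card_pos

theorem IsTwinSet.mulVec_block (hT : IsTwinSet G T κ) (α β : ℝ) (v : V) :
    (G.adjMatrix ℝ).mulVec (fun w => if w ∈ T then α else β) v =
      if v ∈ T then κ * (T.card - 1) * α + (Tᶜ).card * β
      else T.card * α + (∑ w ∈ Tᶜ, G.adjMatrix ℝ v w) * β := by
  rw [Matrix.mulVec, dotProduct, ← Finset.sum_add_sum_compl T]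
  have h2 : ∑ w ∈ Tᶜ, G.adjMatrix ℝ v w * (if w ∈ T then α else β)
      = (∑ w ∈ Tᶜ, G.adjMatrix ℝ v w) * β := by
    rw [Finset.sum_mul]
    refine Finset.sum_congr rfl fun w hw => ?_
    rw [if_neg (Finset.mem_compl.1 hw)]
  have h1 : ∑ w ∈ T, G.adjMatrix ℝ v w * (if w ∈ T then α else β)
      = ∑ w ∈ T, (if v ∈ T then (if v = w then 0 else κ) else 1) * α :=
    Finset.sum_congr rfl fun w hw => by rw [hT.adj w hw, if_pos hw]
  rw [h1, h2]
  split_ifs with hv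
  · have h3 : ∑ w ∈ Tᶜ, G.adjMatrix ℝ v w = (Tᶜ).card := by
      rw [Finset.cast_card]
      refine Finset.sum_congr rfl fun w hw => ?_
      rw [← G.isSymm_adjMatrix.apply, hT.adj v hv, if_neg (Finset.mem_compl.1 hw)]
    have h4 : ∑ w ∈ T, (if v = w then (0 : ℝ) else κ) * α = κ * (T.card - 1) * α := by
      rw [← Finset.sum_mul]
      congr 1
      have : ∀ w ∈ T, (if v = w then (0 : ℝ) else κ) = κ - if v = w then κ else 0 := by
        intro w _; split_ifs <;> simp
      rw [Finset.sum_congr rfl this, Finset.sum_sub_distrib, Finset.sum_ite_eq, if_pos hv,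
        Finset.sum_const, nsmul_eq_mul]
      ring
    rw [h3, h4]
  · rw [Finset.sum_const, nsmul_eq_mul]
    ring

theorem mulVec_single (G : SimpleGraph V) [DecidableRel G.Adj] (u v : V) :
    (G.adjMatrix ℝ).mulVec (fun w => if w = u then 1 else 0) v = G.adjMatrix ℝ v u := by
  simp [Matrix.mulVec, dotProduct]

/-- The deviation `e_u - (1/|T|) 1_T` of a vertex `u` of a twin set `T` from the uniform
distribution on `T`. -/
noncomputable def twinDeviation (T : Finset V) (u : V) (v : V) : ℝ :=
  (if v = u then 1 else 0) - if v ∈ T then (T.card : ℝ)⁻¹ else 0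

theorem IsTwinSet.mulVec_twinDeviation (hT : IsTwinSet G T κ) {u : V} (hu : u ∈ T) :
    (G.adjMatrix ℝ).mulVec (twinDeviation T u) = (-κ) • twinDeviation T u := by
  have ha := hT.card_pos.ne'
  have h : twinDeviation T u
      = (fun w => if w = u then 1 else 0) - fun w => if w ∈ T then (T.card : ℝ)⁻¹ else 0 := rfl
  rw [h, Matrix.mulVec_sub]
  funext v
  rw [Pi.sub_apply, mulVec_single, hT.mulVec_block, hT.adj u hu]
  by_cases hv : v ∈ T
  · by_cases hvu : v = u
    · simp [hvu, hu]; field_simp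
    · simp [hv, hvu]; field_simp; ring
  · have hvu : v ≠ u := fun h => hv (h ▸ hu)
    simp [hv, hvu, ha]

theorem sum_twinDeviation_mul {u : V} (f : V → ℝ) :
    ∑ v, twinDeviation T u v * f v = f u - (T.card : ℝ)⁻¹ * ∑ v ∈ T, f v := by
  simp [twinDeviation, sub_mul, Finset.sum_sub_distrib, ite_mul, Finset.mul_sum]

theorem sum_twinDeviation_sq {u : V} (hu : u ∈ T) :
    ∑ v, twinDeviation T u v ^ 2 = 1 - 1 / (T.card : ℝ) := by
  have ha : (T.card : ℝ) ≠ 0 := by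
    exact_mod_cast (Finset.card_pos.2 ⟨u, hu⟩).ne'
  simp_rw [sq]
  rw [sum_twinDeviation_mul]
  simp only [twinDeviation, if_true, if_pos hu, Finset.sum_sub_distrib]
  rw [Finset.sum_ite_eq', if_pos hu, Finset.sum_congr rfl (fun v hv => if_pos hv),
    Finset.sum_const, nsmul_eq_mul]
  field_simp
  ring

/-- Eigenvectors of a symmetric matrix for different eigenvalues are orthogonal. -/
theorem sum_mul_eq_zero_of_mulVec {x y : V → ℝ} {a b : ℝ}
    (hx : (G.adjMatrix ℝ).mulVec x = a • x) (hy : (G.adjMatrix ℝ).mulVec y = b • y)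
    (hab : a ≠ b) : ∑ v, x v * y v = 0 := by
  have h1 : (G.adjMatrix ℝ).mulVec x ⬝ᵥ y = x ⬝ᵥ (G.adjMatrix ℝ).mulVec y := by
    rw [dotProduct_comm, Matrix.dotProduct_mulVec, ← Matrix.mulVec_transpose,
      G.isSymm_adjMatrix.eq, dotProduct_comm]
  rw [hx, hy, smul_dotProduct, dotProduct_smul, smul_eq_mul, smul_eq_mul] at h1
  have h2 : (a - b) * (x ⬝ᵥ y) = 0 := by rw [sub_mul, h1, sub_self]
  exact (mul_eq_zero.1 h2).resolve_left (sub_ne_zero.2 hab)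

theorem sum_inner_basis_mul (b : OrthonormalBasis V ℝ (EuclideanSpace ℝ V)) (x y : V → ℝ) :
    ∑ j, (∑ v, x v * b j v) * (∑ v, y v * b j v) = ∑ v, x v * y v := by
  have h := b.sum_inner_mul_inner (WithLp.toLp 2 x) (WithLp.toLp 2 y)
  simp only [PiLp.inner_apply, RCLike.inner_apply, conj_trivial] at h
  rw [show ∑ v, x v * y v = ∑ v, y v * x v from Finset.sum_congr rfl fun v _ => mul_comm _ _, ← h]
  refine Finset.sum_congr rfl fun j _ => ?_
  congr 1
  exact Finset.sum_congr rfl fun v _ => mul_comm _ _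

section Weights

variable {lam : V → ℝ} {b : OrthonormalBasis V ℝ (EuclideanSpace ℝ V)}

/-- The eigenvalue of `twinDeviation T u` has weight at least `1 - 1 / |T|` at `u`: that vector lies in the
eigenspace, and both its squared norm and its entry at `u` are `1 - 1 / |T|`. -/
theorem IsTwinSet.le_sum_weight (hT : IsTwinSet G T κ) {u : V} (hu : u ∈ T)
    (hb : ∀ j, (G.adjMatrix ℝ).mulVec (b j) = lam j • (b j : V → ℝ)) :
    1 - 1 / (T.card : ℝ) ≤ ∑ j with lam j = -κ, b j u ^ 2 := by
  set y := twinDeviation T u with hy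
  set S : Finset V := Finset.univ.filter fun j => lam j = -κ with hS
  have hzero : ∀ j ∉ S, ∑ v, y v * b j v = 0 := fun j hj =>
    sum_mul_eq_zero_of_mulVec (hT.mulVec_twinDeviation hu) (hb j)
      (fun h => hj (by simp [hS, h]))
  have hsum : ∀ f : V → ℝ, ∑ j ∈ S, (∑ v, y v * b j v) * (∑ v, f v * b j v)
      = ∑ v, y v * f v := by
    intro f
    rw [← sum_inner_basis_mul b y f]
    refine Finset.sum_subset (Finset.subset_univ _) fun j _ hj => ?_
    rw [hzero j hj, zero_mul]
  have h1 : ∑ j ∈ S, (∑ v, y v * b j v) * b j u = 1 - 1 / (T.card : ℝ) := by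
    have := hsum fun v => if v = u then 1 else 0
    simp only [ite_mul, one_mul, zero_mul, mul_ite, mul_one, mul_zero, Finset.sum_ite_eq',
      Finset.mem_univ, if_true] at this
    rw [this, hy, twinDeviation, if_pos rfl, if_pos hu, one_div]
  have h2 : ∑ j ∈ S, (∑ v, y v * b j v) ^ 2 = 1 - 1 / (T.card : ℝ) := by
    have := hsum y
    simp_rw [← sq] at this
    rw [this, hy, sum_twinDeviation_sq hu]
  -- `0 ≤ ‖y - E e_u‖ ^ 2` with `E` the projection onto the eigenspace
  have h3 : 0 ≤ ∑ j ∈ S, ((∑ v, y v * b j v) - b j u) ^ 2 :=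
    Finset.sum_nonneg fun j _ => sq_nonneg _
  simp only [sub_sq, Finset.sum_add_distrib, Finset.sum_sub_distrib, mul_assoc,
    ← Finset.mul_sum] at h3
  rw [h1, h2] at h3
  linarith

/-- If every eigenvector for `θ` sums to zero over `T`, the eigenspace does not see `1_T`, so that the
weight of `θ` at `u` is at most the squared norm of `twinDeviation T u`. -/
theorem sum_weight_le_of_sum_eq_zero {θ : ℝ} {u : V} (hu : u ∈ T)
    (hker : ∀ x : V → ℝ, (G.adjMatrix ℝ).mulVec x = θ • x → ∑ v ∈ T, x v = 0)
    (hb : ∀ j, (G.adjMatrix ℝ).mulVec (b j) = lam j • (b j : V → ℝ)) :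
    ∑ j with lam j = θ, b j u ^ 2 ≤ 1 - 1 / (T.card : ℝ) := by
  rw [← sum_twinDeviation_sq hu]
  simp_rw [sq]
  rw [← sum_inner_basis_mul b]
  simp_rw [sum_twinDeviation_mul, ← sq]
  refine le_trans (le_of_eq (Finset.sum_congr rfl fun j hj => ?_))
    (Finset.sum_le_sum_of_subset_of_nonneg (Finset.subset_univ _) fun j _ _ => sq_nonneg _)
  rw [hker (b j) (by rw [hb, (Finset.mem_filter.1 hj).2]), mul_zero, sub_zero]

end Weights

theorem IsTwinSet.le_norm_transition (hT : IsTwinSet G T κ) {u : V} (hu : u ∈ T) (t : ℝ) :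
    1 - 2 / (T.card : ℝ) ≤ ‖transition G t u u‖ := by
  obtain ⟨lam, b, hb⟩ := exists_orthonormal_eigenvectors G
  have hw := hT.le_sum_weight hu hb
  have hs := sum_basis_apply_sq b u
  rw [transition_apply_spectral G hb, ← Finset.sum_filter_add_sum_filter_not _ (fun j => lam j = -κ)]
  rw [← Finset.sum_filter_add_sum_filter_not _ (fun j => lam j = -κ)] at hs
  set W := ∑ j with lam j = -κ, b j u ^ 2
  have h1 : ∑ j with lam j = -κ, phase (lam j * t) * ((b j u ^ 2 : ℝ) : ℂ)
      = phase (-κ * t) * (W : ℂ) := by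
    rw [ofReal_sum, Finset.mul_sum]
    exact Finset.sum_congr rfl fun j hj => by rw [(Finset.mem_filter.1 hj).2]
  have h2 : ‖∑ j with ¬ lam j = -κ, phase (lam j * t) * ((b j u ^ 2 : ℝ) : ℂ)‖ ≤ 1 - W := by
    rw [show 1 - W = ∑ j with ¬ lam j = -κ, b j u ^ 2 by linarith]
    refine (norm_sum_le _ _).trans (Finset.sum_le_sum fun j _ => ?_)
    rw [norm_mul, norm_phase, one_mul, norm_real, Real.norm_of_nonneg (sq_nonneg _)]
  have h3 : W ≤ ‖phase (-κ * t) * (W : ℂ)‖ := by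
    rw [norm_mul, norm_phase, one_mul, norm_real]
    exact le_abs_self W
  rw [h1]
  have h4 := norm_sub_le_norm_add (phase (-κ * t) * (W : ℂ))
    (∑ j with ¬ lam j = -κ, phase (lam j * t) * ((b j u ^ 2 : ℝ) : ℂ))
  have h5 : 2 / (T.card : ℝ) = 2 * (1 / T.card) := by ring
  linarith

/-- The convex combination `p e^{ix} + (1 - p) e^{iy}` of two phases. -/
noncomputable def phaseMix (p x y : ℝ) : ℂ := p * phase x + (1 - p) * phase y

/-- The two eigenvalues seen by the all-ones vector of a twin set are the eigenvalues of the
quotient matrix with rows `(κ (a - 1), n - a)` and `(a, ρ)`, whose discriminant is `R ^ 2`. -/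
theorem IsTwinSet.transition_apply (hT : IsTwinSet G T κ) (hρ : IsRegularOutside G T ρ)
    {R : ℝ} (hR : 0 < R)
    (hR2 : R ^ 2 = (κ * (T.card - 1) - ρ) ^ 2 + 4 * T.card * (Tᶜ).card)
    {u v : V} (hu : u ∈ T) (hv : v ∈ T) (t : ℝ) :
    transition G t v u = phase (-κ * t) * ((if v = u then 1 else 0) - 1 / (T.card : ℂ)
      + 1 / (T.card : ℂ) * phaseMix ((1 + (κ * (T.card - 1) - ρ) / R) / 2)
          ((κ * (T.card + 1) + ρ + R) / 2 * t) ((κ * (T.card + 1) + ρ - R) / 2 * t)) := by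
  have ha := hT.card_pos
  set a := (T.card : ℝ) with ha'
  set c := ((Tᶜ).card : ℝ) with hc'
  set δ : ℝ := κ * (a - 1) with hδ
  let lam : Fin 3 → ℝ := ![-κ, (δ + ρ + R) / 2, (δ + ρ - R) / 2]
  let y : Fin 3 → V → ℝ := ![twinDeviation T u,
    fun w => if w ∈ T then a⁻¹ * ((1 + (δ - ρ) / R) / 2) else 1 / R,
    fun w => if w ∈ T then a⁻¹ * ((1 - (δ - ρ) / R) / 2) else -(1 / R)]
  have hblock : ∀ α β μ : ℝ, δ * α + c * β = μ * α → a * α + ρ * β = μ * β →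
      (G.adjMatrix ℝ).mulVec (fun w => if w ∈ T then α else β)
        = μ • fun w => if w ∈ T then α else β := by
    intro α β μ h1 h2
    funext w
    rw [hT.mulVec_block, Pi.smul_apply, smul_eq_mul]
    split_ifs with hw
    · exact h1
    · rw [hρ w hw, h2]
  have hy : ∀ j, (G.adjMatrix ℝ).mulVec (y j) = lam j • y j := by
    intro j
    fin_cases j
    · exact hT.mulVec_twinDeviation hu
    · refine hblock _ _ ((δ + ρ + R) / 2) ?_ ?_
      · field_simp
        linear_combination -hR2
      · field_simp
        ring
    · refine hblock _ _ ((δ + ρ - R) / 2) ?_ ?_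
      · field_simp
        linear_combination hR2
      · field_simp
        ring
  have hsum : ∀ w, ∑ j, y j w = if w = u then 1 else 0 := by
    intro w
    rw [Fin.sum_univ_three]
    change ((if w = u then 1 else 0) - if w ∈ T then a⁻¹ else 0)
      + (if w ∈ T then a⁻¹ * ((1 + (δ - ρ) / R) / 2) else 1 / R)
      + (if w ∈ T then a⁻¹ * ((1 - (δ - ρ) / R) / 2) else -(1 / R)) = _
    by_cases hw : w ∈ T <;> simp only [hw, if_true, if_false] <;> ring
  rw [transition_apply_of_eigenvectors G lam y hy hsum, Fin.sum_univ_three]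
  change phase (-κ * t) * (((if v = u then 1 else 0) - if v ∈ T then a⁻¹ else 0 : ℝ) : ℂ)
    + phase ((δ + ρ + R) / 2 * t)
      * ((if v ∈ T then a⁻¹ * ((1 + (δ - ρ) / R) / 2) else 1 / R : ℝ) : ℂ)
    + phase ((δ + ρ - R) / 2 * t)
      * ((if v ∈ T then a⁻¹ * ((1 - (δ - ρ) / R) / 2) else -(1 / R) : ℝ) : ℂ) = _
  rw [if_pos hv, if_pos hv, if_pos hv]
  rw [phaseMix, show (κ * (a + 1) + ρ + R) / 2 * t = κ * t + (δ + ρ + R) / 2 * t by rw [hδ]; ring,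
    show (κ * (a + 1) + ρ - R) / 2 * t = κ * t + (δ + ρ - R) / 2 * t by rw [hδ]; ring,
    phase_add, phase_add]
  have h1 : phase (-κ * t) * phase (κ * t) = 1 := by rw [← phase_add, ← phase_zero]; congr 1; ring
  have hac : (T.card : ℂ) = (a : ℂ) := by simp [ha']
  rw [hac]
  have hite : (((if v = u then (1 : ℝ) else 0) : ℝ) : ℂ) = if v = u then 1 else 0 := by
    split_ifs <;> simp
  push_cast
  rw [hite]
  have ha0 : (a : ℂ) ≠ 0 := by exact_mod_cast ha.ne'
  have hR0 : (R : ℂ) ≠ 0 := by exact_mod_cast hR.ne'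
  generalize phase (-κ * t) = z at h1 ⊢
  generalize phase (κ * t) = z' at h1 ⊢
  generalize phase ((δ + ρ + R) / 2 * t) = x
  generalize phase ((δ + ρ - R) / 2 * t) = y
  field_simp
  linear_combination (-(R + (δ - ρ)) * x - (R - (δ - ρ)) * y) * h1

end

/-! ### 2-adic valuations and simultaneous phases -/

section TwoAdic

theorem nu2_eq_zero_of_odd {x : ℤ} (h : Odd x) : nu2 x = 0 :=
  emultiplicity_eq_zero.2 fun hd => Int.not_even_iff_odd.2 h (even_iff_two_dvd.2 hd)

theorem nu2_mul (x y : ℤ) : nu2 (x * y) = nu2 x + nu2 y := emultiplicity_mul Int.prime_two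

theorem nu2_ne_top {x : ℤ} (h : x ≠ 0) : nu2 x ≠ ⊤ :=
  finiteMultiplicity_iff_emultiplicity_ne_top.1
    (Int.finiteMultiplicity_iff.2 ⟨by norm_num, h⟩)

/-- If the valuations of the sum and the difference of `g X` and `g Y` differ, then `X + Y` and `X - Y` are
even. -/
theorem odd_of_nu2_add_ne_nu2_sub {g X Y : ℤ} (hXY : IsCoprime X Y)
    (h : nu2 (g * X + g * Y) ≠ nu2 (g * X - g * Y)) : Odd X ∧ Odd Y := by
  rw [← mul_add, ← mul_sub, nu2_mul, nu2_mul] at h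
  by_contra hc
  have hodd : Odd (X + Y) ∧ Odd (X - Y) := by
    rcases Int.even_or_odd X with hX | hX <;> rcases Int.even_or_odd Y with hY | hY
    · exact absurd (hXY.isUnit_of_dvd' (even_iff_two_dvd.1 hX) (even_iff_two_dvd.1 hY))
        Int.prime_two.not_isUnit
    · exact ⟨hX.add_odd hY, hX.sub_odd hY⟩
    · exact ⟨hX.add_even hY, hX.sub_even hY⟩
    · exact absurd ⟨hX, hY⟩ hc
  exact h (by rw [nu2_eq_zero_of_odd hodd.1, nu2_eq_zero_of_odd hodd.2])

theorem nu2_add_ne_nu2_sub_of_odd {g X Y : ℤ} (hg : g ≠ 0) (hX : Odd X) (hY : Odd Y) :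
    nu2 (g * X + g * Y) ≠ nu2 (g * X - g * Y) := by
  rw [← mul_add, ← mul_sub, nu2_mul, nu2_mul]
  intro h
  have h1 : nu2 (X + Y) = nu2 (X - Y) := by
    exact ENat.add_right_injective_of_ne_top (nu2_ne_top hg) h
  obtain ⟨i, rfl⟩ := hX
  obtain ⟨j, rfl⟩ := hY
  rw [show 2 * i + 1 + (2 * j + 1) = 2 * (i + j + 1) by ring,
    show 2 * i + 1 - (2 * j + 1) = 2 * (i - j) by ring, nu2_mul, nu2_mul] at h1
  have h2 : nu2 (i + j + 1) = nu2 (i - j) :=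
    ENat.add_right_injective_of_ne_top (nu2_ne_top two_ne_zero) h1
  have hdvd : ∀ {z w : ℤ}, nu2 z = nu2 w → (2 ∣ z ↔ 2 ∣ w) := by
    intro z w hzw
    rw [← not_iff_not, ← emultiplicity_eq_zero, ← emultiplicity_eq_zero]
    unfold nu2 at hzw
    rw [hzw]
  have := hdvd h2
  omega

/-- If `ν₂(b) ≠ ν₂(q)`, then `(b + q) / 2` and `(b - q) / 2` are odd multiples of their greatest common
divisor `e`. -/
theorem exists_odd_of_nu2_ne {b q : ℤ} (hbq : Even (b + q)) (hq : q ≠ 0) (h : nu2 b ≠ nu2 q) :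
    ∃ e X Y : ℤ, 0 < e ∧ (Int.gcd (b + q) (b - q) : ℤ) = 2 * e ∧ b + q = 2 * (e * X) ∧
      b - q = 2 * (e * Y) ∧ Odd X ∧ Odd Y := by
  obtain ⟨x, hx⟩ := hbq
  have hy : b - q = 2 * (b - x) := by linarith
  have hx' : b + q = 2 * x := by linarith
  set y := b - x with hyd
  have hg : 0 < Int.gcd x y := Int.gcd_pos_iff.2 (by
    by_contra hc
    push Not at hc
    apply hq; linarith [hc.1, hc.2])
  obtain ⟨e, X, Y, he, hcop, hX, hY⟩ : ∃ e X Y : ℤ, e = Int.gcd x y ∧ IsCoprime X Y ∧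
      x = e * X ∧ y = e * Y := by
    obtain ⟨X, Y, hXY, hX, hY⟩ := Int.exists_gcd_one hg
    exact ⟨_, X, Y, rfl, Int.isCoprime_iff_gcd_eq_one.2 hXY, by rw [mul_comm]; exact hX,
      by rw [mul_comm]; exact hY⟩
  have hb : b = e * X + e * Y := by rw [← hX, ← hY]; linarith
  have hqe : q = e * X - e * Y := by rw [← hX, ← hY]; linarith
  obtain ⟨hXo, hYo⟩ := odd_of_nu2_add_ne_nu2_sub (g := e) hcop (by rw [← hb, ← hqe]; exact h)
  refine ⟨e, X, Y, by rw [he]; exact_mod_cast hg, ?_, by rw [hx', hX], by rw [hy, hY], hXo, hYo⟩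
  rw [hx', hy, Int.gcd_mul_left, he]
  push_cast; rfl

theorem nu2_ne_of_odd_mul_eq {x y i j : ℤ} (hx : x ≠ 0) (hi : Odd i) (hj : Odd j)
    (h : x * i = y * j) : nu2 (x + y) ≠ nu2 (x - y) := by
  have hg : 0 < Int.gcd x y := Int.gcd_pos_iff.2 (Or.inl hx)
  obtain ⟨X, Y, hXY, hX, hY⟩ := Int.exists_gcd_one hg
  have hg' : (Int.gcd x y : ℤ) ≠ 0 := by exact_mod_cast hg.ne'
  have h2 : X * i = Y * j := by
    apply mul_left_cancel₀ hg'
    calc (Int.gcd x y : ℤ) * (X * i) = X * Int.gcd x y * i := by ring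
      _ = Y * Int.gcd x y * j := by rw [← hX, ← hY, h]
      _ = _ := by ring
  have hpar : Odd X ↔ Odd Y := by
    have h3 : Odd (X * i) ↔ Odd (Y * j) := by rw [h2]
    simpa [Int.odd_mul, hi, hj] using h3
  have hodd : Odd X ∧ Odd Y := by
    by_contra hc
    have hX' : Even X := by rw [← Int.not_odd_iff_even]; tauto
    have hY' : Even Y := by rw [← Int.not_odd_iff_even]; tauto
    have hcop := Int.isCoprime_iff_gcd_eq_one.2 hXY
    exact Int.prime_two.not_isUnit
      (hcop.isUnit_of_dvd' (even_iff_two_dvd.1 hX') (even_iff_two_dvd.1 hY'))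
  have := nu2_add_ne_nu2_sub_of_odd hg' hodd.1 hodd.2
  rwa [mul_comm, ← hX, mul_comm, ← hY] at this

end TwoAdic

section Phases

theorem phase_eq_neg_one_of_nu2_ne {b q : ℤ} (hbq : Even (b + q)) (hq : q ≠ 0)
    (h : nu2 b ≠ nu2 q) {j : ℤ} (hj : Odd j) :
    phase (((b : ℝ) + q) / 2 * (2 * j * Real.pi / Int.gcd (b + q) (b - q))) = -1 ∧
    phase (((b : ℝ) - q) / 2 * (2 * j * Real.pi / Int.gcd (b + q) (b - q))) = -1 := by
  obtain ⟨e, X, Y, he, hg, hX, hY, hXo, hYo⟩ := exists_odd_of_nu2_ne hbq hq h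
  have hg' : ((Int.gcd (b + q) (b - q) : ℕ) : ℝ) = 2 * e := by exact_mod_cast hg
  have hX' : (b : ℝ) + q = 2 * (e * X) := by exact_mod_cast hX
  have hY' : (b : ℝ) - q = 2 * (e * Y) := by exact_mod_cast hY
  have he' : (e : ℝ) ≠ 0 := by exact_mod_cast he.ne'
  rw [hg', hX', hY']
  refine ⟨(phase_eq_neg_one_iff _).2 ⟨X * j, hXo.mul hj, ?_⟩,
    (phase_eq_neg_one_iff _).2 ⟨Y * j, hYo.mul hj, ?_⟩⟩
  · push_cast; field_simp
  · push_cast; field_simp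

theorem gcd_pos_of_nu2_ne {b q : ℤ} (hbq : Even (b + q)) (hq : q ≠ 0) (h : nu2 b ≠ nu2 q) :
    0 < (Int.gcd (b + q) (b - q) : ℝ) := by
  obtain ⟨e, X, Y, he, hg, -⟩ := exists_odd_of_nu2_ne hbq hq h
  have : (0 : ℤ) < Int.gcd (b + q) (b - q) := by omega
  exact_mod_cast this

theorem nu2_ne_of_phase_eq_neg_one {b q : ℤ} (hbq : Even (b + q)) {t : ℝ}
    (h1 : phase (((b : ℝ) + q) / 2 * t) = -1) (h2 : phase (((b : ℝ) - q) / 2 * t) = -1) :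
    nu2 b ≠ nu2 q := by
  obtain ⟨x, hx⟩ := hbq
  obtain ⟨y, hy⟩ : ∃ y, b - q = y + y := ⟨b - x, by linarith⟩
  have hx' : ((b : ℝ) + q) / 2 = x := by
    have : (b : ℝ) + q = x + x := by exact_mod_cast hx
    linarith
  have hy' : ((b : ℝ) - q) / 2 = y := by
    have : (b : ℝ) - q = y + y := by exact_mod_cast hy
    linarith
  rw [hx', phase_eq_neg_one_iff] at h1
  rw [hy', phase_eq_neg_one_iff] at h2
  obtain ⟨i, hi, h1⟩ := h1
  obtain ⟨j, hj, h2⟩ := h2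
  have hi0 : (i : ℝ) ≠ 0 := by
    rintro h
    have : i = 0 := by exact_mod_cast h
    simp [this] at hi
  have hx0 : x ≠ 0 := by
    rintro rfl
    rw [Int.cast_zero, zero_mul] at h1
    exact (mul_ne_zero hi0 Real.pi_ne_zero) h1.symm
  have ht : t ≠ 0 := by
    rintro rfl
    rw [mul_zero] at h1
    exact (mul_ne_zero hi0 Real.pi_ne_zero) h1.symm
  have hxy : x * j = y * i := by
    have : (x : ℝ) * j = y * i := by
      have e1 : ((x : ℝ) * j) * (t * Real.pi) = (y * i) * (t * Real.pi) := by
        linear_combination (j * Real.pi) * h1 - (i * Real.pi) * h2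
      exact mul_right_cancel₀ (mul_ne_zero ht Real.pi_ne_zero) e1
    exact_mod_cast this
  have := nu2_ne_of_odd_mul_eq hx0 hj hi hxy
  rwa [show x + y = b by linarith, show x - y = q by linarith] at this

theorem irrational_of_sq_eq {R : ℝ} (hR : 0 < R) {Δ : ℤ} (hΔ : R ^ 2 = Δ) (h : ¬ IsSquare Δ) :
    Irrational R := by
  have : R = √(Δ : ℝ) := by rw [← hΔ, Real.sqrt_sq hR.le]
  rw [this, irrational_sqrt_intCast_iff]
  refine ⟨h, ?_⟩
  have : (0 : ℝ) ≤ Δ := by rw [← hΔ]; positivity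
  exact_mod_cast this

theorem linearIndependent_pair_of_irrational {b : ℤ} (hb : b ≠ 0) {R : ℝ} (hR : Irrational R) :
    LinearIndependent ℚ ![((b : ℝ) + R) / 2, ((b : ℝ) - R) / 2] := by
  rw [LinearIndependent.pair_iff]
  intro s t h
  rw [Rat.smul_def, Rat.smul_def] at h
  have hst : s = t := by
    by_contra hne
    have hne' : ((s - t : ℚ) : ℝ) ≠ 0 := by exact_mod_cast sub_ne_zero.2 hne
    refine hR ⟨-((s + t) * b) / (s - t), ?_⟩
    push_cast at hne' ⊢
    rw [div_eq_iff hne']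
    linear_combination -2 * h
  subst hst
  have hs : (s : ℝ) * b = 0 := by linear_combination h
  have hb' : (b : ℝ) ≠ 0 := by exact_mod_cast hb
  have : (s : ℝ) = 0 := (mul_eq_zero.1 hs).resolve_right hb'
  have : s = 0 := by exact_mod_cast this
  exact ⟨this, this⟩

/-- If `b = 0` the two phases are conjugate and can be equal to `-1` simultaneously; otherwise this
is Kronecker's approximation theorem. -/
theorem exists_phases_near_neg_one {b Δ : ℤ} {R : ℝ} (hR : 0 < R) (hΔ : R ^ 2 = Δ)
    (h : b = 0 ∨ ¬ IsSquare Δ) {ε : ℝ} (hε : 0 < ε) (T₀ : ℝ) :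
    ∃ t > T₀, ‖phase (((b : ℝ) + R) / 2 * t) + 1‖ < ε ∧
      ‖phase (((b : ℝ) - R) / 2 * t) + 1‖ < ε := by
  by_cases hb : b = 0
  · obtain ⟨m, hm⟩ := exists_nat_gt (T₀ / (4 * Real.pi / R))
    rw [div_lt_iff₀ (by positivity)] at hm
    refine ⟨m * (4 * Real.pi / R) + 2 * Real.pi / R, ?_, ?_⟩
    · have : 0 < 2 * Real.pi / R := by positivity
      linarith
    · have h1 : phase (((b : ℝ) + R) / 2 * (m * (4 * Real.pi / R) + 2 * Real.pi / R)) = -1 := by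
        rw [phase_eq_neg_one_iff]
        refine ⟨2 * m + 1, odd_two_mul_add_one _, ?_⟩
        rw [hb]; push_cast; field_simp; ring
      have h2 : phase (((b : ℝ) - R) / 2 * (m * (4 * Real.pi / R) + 2 * Real.pi / R)) = -1 := by
        rw [phase_eq_neg_one_iff]
        refine ⟨2 * (-m - 1) + 1, odd_two_mul_add_one _, ?_⟩
        rw [hb]; push_cast; field_simp; ring
      rw [h1, h2]
      simpa using hε
  · have hind := linearIndependent_pair_of_irrational hb
      (irrational_of_sq_eq hR hΔ (h.resolve_left hb))
    obtain ⟨t, ht, hi⟩ := exists_forall_phase_near_neg_one _ hind T₀ hε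
    exact ⟨t, ht, hi 0, hi 1⟩

end Phases

section Mix

variable {p : ℝ}

theorem norm_phaseMix_le_one (hp0 : 0 ≤ p) (hp1 : p ≤ 1) (x y : ℝ) : ‖phaseMix p x y‖ ≤ 1 := by
  have h1 : ‖(p : ℂ) * phase x‖ = p := by
    rw [norm_mul, norm_phase, mul_one, norm_real, Real.norm_of_nonneg hp0]
  have h2 : ‖(1 - p : ℂ) * phase y‖ = 1 - p := by
    rw [norm_mul, norm_phase, mul_one, ← ofReal_one, ← ofReal_sub, norm_real,
      Real.norm_of_nonneg (by linarith)]
  unfold phaseMix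
  refine (norm_add_le _ _).trans ?_
  rw [h1, h2]; linarith

theorem phaseMix_re (x y : ℝ) : (phaseMix p x y).re = p * Real.cos x + (1 - p) * Real.cos y := by
  rw [phaseMix, ← ofReal_one, ← ofReal_sub, add_re, re_ofReal_mul, re_ofReal_mul, phase_re,
    phase_re]

theorem phase_eq_neg_one_of_cos_le {x : ℝ} (h : Real.cos x ≤ -1) : phase x = -1 := by
  have hc : Real.cos x = -1 := le_antisymm h (Real.neg_one_le_cos x)
  have hs : Real.sin x = 0 := by nlinarith [Real.sin_sq_add_cos_sq x]
  rw [phase_eq_cos_add_sin, hc, hs]; simp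

theorem phases_eq_neg_one_of_phaseMix_re_le (hp0 : 0 < p) (hp1 : p < 1) {x y : ℝ}
    (h : (phaseMix p x y).re ≤ -1) : phase x = -1 ∧ phase y = -1 := by
  rw [phaseMix_re] at h
  have hx := Real.neg_one_le_cos x
  have hy := Real.neg_one_le_cos y
  constructor
  · refine phase_eq_neg_one_of_cos_le ?_
    by_contra hc
    nlinarith
  · refine phase_eq_neg_one_of_cos_le ?_
    by_contra hc
    nlinarith

theorem phaseMix_add_one (x y : ℝ) :
    phaseMix p x y + 1 = p * (phase x + 1) + (1 - p) * (phase y + 1) := by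
  unfold phaseMix; ring

theorem norm_phaseMix_add_one_le (hp0 : 0 ≤ p) (hp1 : p ≤ 1) {x y ε : ℝ}
    (hx : ‖phase x + 1‖ ≤ ε) (hy : ‖phase y + 1‖ ≤ ε) : ‖phaseMix p x y + 1‖ ≤ ε := by
  rw [phaseMix_add_one]
  refine (norm_add_le _ _).trans ?_
  rw [norm_mul, norm_mul, norm_real, Real.norm_of_nonneg hp0, ← ofReal_one, ← ofReal_sub,
    norm_real, Real.norm_of_nonneg (by linarith : (0 : ℝ) ≤ 1 - p), ofReal_one]
  nlinarith

end Mix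

/-! ### Walks governed by two phases -/

section

variable {V : Type*} [Fintype V] [DecidableEq V]

/-- Up to a global phase, the walk on the vertices of `T` is the one governed by the quotient of
`G` by the partition `{T, Tᶜ}`: besides the eigenvalue carried by differences of twins there are
two more phases, of rates `(b ± √Δ) / 2` relative to it, both with positive weight. -/
structure IsTwoPhaseWalk (G : SimpleGraph V) [DecidableRel G.Adj] (T : Finset V) (b Δ : ℤ) :
    Prop where
  card_pos : 0 < T.card
  discr_pos : 0 < Δ
  even : Even (b ^ 2 - Δ)
  exists_weight : ∃ p : ℝ, 0 < p ∧ p < 1 ∧ ∀ u ∈ T, ∀ v ∈ T, ∀ t : ℝ,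
    ‖transition G t v u‖ = ‖(if v = u then 1 else 0) - 1 / (T.card : ℂ)
      + 1 / (T.card : ℂ) * phaseMix p (((b : ℝ) + √Δ) / 2 * t) (((b : ℝ) - √Δ) / 2 * t)‖

variable {G : SimpleGraph V} [DecidableRel G.Adj] {T : Finset V}

/-- Both eigenvectors of the quotient have positive weight, since its off-diagonal entries do not vanish. -/
theorem quotient_weight_mem_Ioo {x y R : ℝ} (hR : 0 < R) (hR2 : R ^ 2 = x ^ 2 + y) (hy : 0 < y) :
    0 < (1 + x / R) / 2 ∧ (1 + x / R) / 2 < 1 := by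
  have h : |x| < R := abs_lt_of_sq_lt_sq (by linarith) hR.le
  rw [abs_lt] at h
  have h1 : -1 < x / R := by rw [lt_div_iff₀ hR]; linarith
  have h2 : x / R < 1 := by rw [div_lt_iff₀ hR]; linarith
  constructor <;> linarith

theorem IsTwinSet.isTwoPhaseWalk {κ ρ : ℝ} (hT : IsTwinSet G T κ) (hρ : IsRegularOutside G T ρ)
    (hc : (Tᶜ).Nonempty) {b Δ : ℤ} (hb : (b : ℝ) = κ * (T.card + 1) + ρ)
    (hΔ : (Δ : ℝ) = (κ * (T.card - 1) - ρ) ^ 2 + 4 * T.card * (Tᶜ).card)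
    (hev : Even (b ^ 2 - Δ)) : IsTwoPhaseWalk G T b Δ := by
  have ha := hT.card_pos
  have hc' : (0 : ℝ) < (Tᶜ).card := by exact_mod_cast hc.card_pos
  have hΔ0 : (0 : ℝ) < Δ := by rw [hΔ]; positivity
  have hR : 0 < √(Δ : ℝ) := Real.sqrt_pos.2 hΔ0
  have hR2 : √(Δ : ℝ) ^ 2 = (κ * (T.card - 1) - ρ) ^ 2 + 4 * T.card * (Tᶜ).card := by
    rw [Real.sq_sqrt hΔ0.le, hΔ]
  obtain ⟨hp0, hp1⟩ := quotient_weight_mem_Ioo hR hR2 (by positivity)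
  refine ⟨hT.nonempty.card_pos, by exact_mod_cast hΔ0, hev, _, hp0, hp1, fun u hu v hv t => ?_⟩
  rw [hT.transition_apply hρ hR hR2 hu hv, norm_mul, norm_phase, one_mul, hb]

namespace IsTwoPhaseWalk

variable {b Δ : ℤ} {u v : V}

theorem le_norm_transition (h : IsTwoPhaseWalk G T b Δ) (hu : u ∈ T) (t : ℝ) :
    1 - 2 / (T.card : ℝ) ≤ ‖transition G t u u‖ := by
  obtain ⟨p, hp0, hp1, hU⟩ := h.exists_weight
  have ha : (0 : ℝ) < T.card := by exact_mod_cast h.card_pos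
  rw [hU u hu u hu, if_pos rfl]
  refine le_trans ?_ (Complex.re_le_norm _)
  have h1 := (Complex.abs_re_le_norm _).trans (norm_phaseMix_le_one hp0.le hp1.le
    (((b : ℝ) + √Δ) / 2 * t) (((b : ℝ) - √Δ) / 2 * t))
  rw [abs_le] at h1
  have h2 : (1 / (T.card : ℂ)) = ((1 / (T.card : ℝ) : ℝ) : ℂ) := by push_cast; rfl
  rw [h2, add_re, sub_re, re_ofReal_mul, one_re, ofReal_re]
  have h3 : 2 / (T.card : ℝ) = 2 * (1 / T.card) := by ring
  have h4 : 0 < 1 / (T.card : ℝ) := by positivity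
  nlinarith [h1.1]

/-- If both phases are close to `-1`, the return probability is close to its lower bound. -/
theorem norm_transition_le_of_near (h : IsTwoPhaseWalk G T b Δ) (ha : 2 ≤ T.card) (hu : u ∈ T)
    {t ε : ℝ} (h1 : ‖phase (((b : ℝ) + √Δ) / 2 * t) + 1‖ ≤ ε)
    (h2 : ‖phase (((b : ℝ) - √Δ) / 2 * t) + 1‖ ≤ ε) :
    ‖transition G t u u‖ ≤ 1 - 2 / (T.card : ℝ) + ε := by
  obtain ⟨p, hp0, hp1, hU⟩ := h.exists_weight
  have ha' : (2 : ℝ) ≤ T.card := by exact_mod_cast ha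
  rw [hU u hu u hu, if_pos rfl]
  have h3 := norm_phaseMix_add_one_le hp0.le hp1.le h1 h2
  set ψ := phaseMix p (((b : ℝ) + √Δ) / 2 * t) (((b : ℝ) - √Δ) / 2 * t)
  have h4 : (1 : ℂ) - 1 / (T.card : ℂ) + 1 / (T.card : ℂ) * ψ
      = ((1 - 2 / (T.card : ℝ) : ℝ) : ℂ) + ((1 / (T.card : ℝ) : ℝ) : ℂ) * (ψ + 1) := by
    push_cast; ring
  have h5 : (1 : ℝ) / T.card ≤ 1 := by rw [div_le_one (by linarith)]; linarith
  have h6 : 0 ≤ 1 - 2 / (T.card : ℝ) := by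
    rw [sub_nonneg, div_le_one (by linarith)]; exact ha'
  rw [h4]
  refine (norm_add_le _ _).trans ?_
  rw [norm_mul, norm_real, norm_real, Real.norm_of_nonneg h6,
    Real.norm_of_nonneg (by positivity : (0 : ℝ) ≤ 1 / T.card)]
  have : 1 / (T.card : ℝ) * ‖ψ + 1‖ ≤ 1 * ε :=
    mul_le_mul h5 h3 (norm_nonneg _) zero_le_one
  linarith

/-- Equality in the triangle inequality forces both phases to be `-1`. -/
theorem phases_eq_neg_one_of_norm_le (h : IsTwoPhaseWalk G T b Δ) (hu : u ∈ T) {t : ℝ}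
    (ht : ‖transition G t u u‖ ≤ 1 - 2 / (T.card : ℝ)) :
    phase (((b : ℝ) + √Δ) / 2 * t) = -1 ∧ phase (((b : ℝ) - √Δ) / 2 * t) = -1 := by
  obtain ⟨p, hp0, hp1, hU⟩ := h.exists_weight
  have ha : (0 : ℝ) < T.card := by exact_mod_cast h.card_pos
  rw [hU u hu u hu, if_pos rfl] at ht
  refine phases_eq_neg_one_of_phaseMix_re_le hp0 hp1 ?_
  have h1 := (Complex.re_le_norm _).trans ht
  have h2 : (1 / (T.card : ℂ)) = ((1 / (T.card : ℝ) : ℝ) : ℂ) := by push_cast; rfl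
  rw [h2, add_re, sub_re, re_ofReal_mul, one_re, ofReal_re] at h1
  have h3 : 2 / (T.card : ℝ) = 2 * (1 / T.card) := by ring
  have h4 : 0 < 1 / (T.card : ℝ) := by positivity
  rw [h3] at h1
  by_contra hc
  nlinarith

/-- If both phases are close to `-1`, the walk on a pair of twins is close to the swap. -/
theorem one_sub_le_norm_transition_of_near (h : IsTwoPhaseWalk G T b Δ) (ha : T.card = 2)
    (hu : u ∈ T) (hv : v ∈ T) (huv : u ≠ v) {t ε : ℝ}
    (h1 : ‖phase (((b : ℝ) + √Δ) / 2 * t) + 1‖ ≤ ε)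
    (h2 : ‖phase (((b : ℝ) - √Δ) / 2 * t) + 1‖ ≤ ε) :
    1 - ε ≤ ‖transition G t u v‖ ∧ ‖transition G t u v‖ ≤ 1 := by
  obtain ⟨p, hp0, hp1, hU⟩ := h.exists_weight
  rw [hU v hv u hu, if_neg huv, ha]
  have h3 := norm_phaseMix_add_one_le hp0.le hp1.le h1 h2
  have h3' := norm_phaseMix_le_one hp0.le hp1.le (((b : ℝ) + √Δ) / 2 * t) (((b : ℝ) - √Δ) / 2 * t)
  set ψ := phaseMix p (((b : ℝ) + √Δ) / 2 * t) (((b : ℝ) - √Δ) / 2 * t)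
  have h4 : (0 : ℂ) - 1 / ((2 : ℕ) : ℂ) + 1 / ((2 : ℕ) : ℂ) * ψ = (1 / 2) * (ψ - 1) := by
    push_cast; ring
  rw [h4, norm_mul]
  have h5 : ‖(1 / 2 : ℂ)‖ = 1 / 2 := by simp
  rw [h5]
  have h6 : ‖ψ - 1‖ ≤ 2 := (norm_sub_le _ _).trans (by rw [norm_one]; linarith)
  have h7 : (2 : ℝ) ≤ ‖ψ + 1‖ + ‖ψ - 1‖ := by
    have := norm_sub_le (ψ + 1) (ψ - 1)
    rw [show ψ + 1 - (ψ - 1) = 2 by ring] at this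
    simpa using this
  have h8 : 0 ≤ ε := (norm_nonneg _).trans h3
  constructor <;> linarith

theorem sqrt_eq_of_sq (q : ℕ) (hq : Δ = (q : ℤ) ^ 2) : √(Δ : ℝ) = ((q : ℤ) : ℝ) := by
  rw [hq]; push_cast; exact Real.sqrt_sq (Nat.cast_nonneg q)

theorem even_add (h : IsTwoPhaseWalk G T b Δ) {q : ℕ} (hq : Δ = (q : ℤ) ^ 2) :
    Even (b + (q : ℤ)) := by
  have := h.even
  rw [hq] at this
  simpa [Int.even_sub, Int.even_pow, Int.even_add] using this

theorem root_ne_zero (h : IsTwoPhaseWalk G T b Δ) {q : ℕ} (hq : Δ = (q : ℤ) ^ 2) :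
    (q : ℤ) ≠ 0 := by
  intro h0
  have := h.discr_pos
  rw [hq, h0] at this
  norm_num at this

theorem phases_eq_neg_one (h : IsTwoPhaseWalk G T b Δ) {q : ℕ} (hq : Δ = (q : ℤ) ^ 2)
    (hne : nu2 b ≠ nu2 q) {g : ℕ} (hg : g = Int.gcd (b + q) (b - q)) {j : ℤ} (hj : Odd j) :
    phase (((b : ℝ) + √Δ) / 2 * (2 * j * Real.pi / g)) = -1 ∧
    phase (((b : ℝ) - √Δ) / 2 * (2 * j * Real.pi / g)) = -1 := by
  rw [sqrt_eq_of_sq q hq, hg]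
  exact phase_eq_neg_one_of_nu2_ne (h.even_add hq) (h.root_ne_zero hq) hne hj

theorem time_pos (h : IsTwoPhaseWalk G T b Δ) {q : ℕ} (hq : Δ = (q : ℤ) ^ 2)
    (hne : nu2 b ≠ nu2 q) {g : ℕ} (hg : g = Int.gcd (b + q) (b - q)) {j : ℤ} (hj : 0 < j) :
    0 < 2 * (j : ℝ) * Real.pi / g := by
  have h1 := gcd_pos_of_nu2_ne (h.even_add hq) (h.root_ne_zero hq) hne
  rw [← hg] at h1
  have h2 : (0 : ℝ) < j := by exact_mod_cast hj
  positivity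

theorem isTightlySedentaryAt (h : IsTwoPhaseWalk G T b Δ) (ha : 3 ≤ T.card) (hu : u ∈ T)
    {q : ℕ} (hq : Δ = (q : ℤ) ^ 2) (hne : nu2 b ≠ nu2 q) {g : ℕ}
    (hg : g = Int.gcd (b + q) (b - q)) {j : ℤ} (hj : Odd j) (hj0 : 0 < j) :
    IsTightlySedentaryAt G u (1 - 2 / (T.card : ℝ)) (2 * j * Real.pi / g) := by
  obtain ⟨h1, h2⟩ := h.phases_eq_neg_one hq hne hg hj
  have ha' : (3 : ℝ) ≤ T.card := by exact_mod_cast ha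
  refine isTightlySedentaryAt_of_forall_le ?_ (h.le_norm_transition hu)
    (h.time_pos hq hne hg hj0) (le_antisymm ?_ (h.le_norm_transition hu _))
  · rw [sub_pos, div_lt_one (by linarith)]; linarith
  · have := h.norm_transition_le_of_near (by omega) hu (ε := 0) (by rw [h1]; simp)
      (by rw [h2]; simp)
    linarith

theorem exists_isTightlySedentary (h : IsTwoPhaseWalk G T b Δ) (ha : 2 ≤ T.card) (hu : u ∈ T)
    {q : ℕ} (hq : Δ = (q : ℤ) ^ 2) (heq : nu2 b = nu2 q) :
    ∃ C, 1 - 2 / (T.card : ℝ) < C ∧ IsTightlySedentary G u C := by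
  have ha' : (2 : ℝ) ≤ T.card := by exact_mod_cast ha
  refine exists_isTightlySedentary_of_periodic ?_ Real.two_pi_pos ?_ fun t => ?_
  · rw [sub_nonneg, div_le_one (by linarith)]; exact ha'
  · -- both rates are integers
    intro t
    obtain ⟨p, -, -, hU⟩ := h.exists_weight
    obtain ⟨x, hx⟩ := h.even_add hq
    have hx1 : ((b : ℝ) + √Δ) / 2 = x := by
      rw [sqrt_eq_of_sq q hq]
      have : (b : ℝ) + (q : ℤ) = x + x := by exact_mod_cast hx
      linarith
    have hx2 : ((b : ℝ) - √Δ) / 2 = (x - q : ℤ) := by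
      rw [sqrt_eq_of_sq q hq] at hx1 ⊢
      push_cast at hx1 ⊢
      linarith
    simp only [hU u hu u hu, hx1, hx2, mul_add, phaseMix, phase_add_int_mul_two_pi]
  · by_contra hc
    push Not at hc
    obtain ⟨h1, h2⟩ := h.phases_eq_neg_one_of_norm_le hu hc
    rw [sqrt_eq_of_sq q hq] at h1 h2
    exact nu2_ne_of_phase_eq_neg_one (h.even_add hq) h1 h2 heq

theorem exists_near (h : IsTwoPhaseWalk G T b Δ) (hb : b = 0 ∨ ¬ IsSquare Δ) {ε : ℝ} (hε : 0 < ε)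
    (T₀ : ℝ) : ∃ t > T₀, ‖phase (((b : ℝ) + √Δ) / 2 * t) + 1‖ < ε ∧
      ‖phase (((b : ℝ) - √Δ) / 2 * t) + 1‖ < ε := by
  have hΔ : (0 : ℝ) < Δ := by exact_mod_cast h.discr_pos
  exact exists_phases_near_neg_one (Real.sqrt_pos.2 hΔ) (Real.sq_sqrt hΔ.le) hb hε T₀

theorem isSharplySedentary (h : IsTwoPhaseWalk G T b Δ) (ha : 3 ≤ T.card) (hu : u ∈ T)
    (hb : b = 0 ∨ ¬ IsSquare Δ) : IsSharplySedentary G u (1 - 2 / (T.card : ℝ)) := by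
  have ha' : (3 : ℝ) ≤ T.card := by exact_mod_cast ha
  refine isSharplySedentary_of_forall_le ?_ (h.le_norm_transition hu) fun ε hε => ?_
  · rw [sub_pos, div_lt_one (by linarith)]; linarith
  · obtain ⟨t, ht, h1, h2⟩ := h.exists_near hb hε 0
    exact ⟨t, ht, h.norm_transition_le_of_near (by omega) hu h1.le h2.le⟩

/-- Both phases come close to `-1`, so that `U(t)_{u,u}` comes close to `1 - 2 / 2 = 0`. -/
theorem isNotSedentary (h : IsTwoPhaseWalk G T b Δ) (ha : T.card = 2) (hu : u ∈ T)
    (hb : b = 0 ∨ ¬ IsSquare Δ) : IsNotSedentary G u := by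
  refine isNotSedentary_of_forall_exists fun ε hε => ?_
  obtain ⟨t, ht, h1, h2⟩ := h.exists_near hb hε 0
  refine ⟨t, ht, ?_⟩
  have := h.norm_transition_le_of_near (by omega) hu h1.le h2.le
  rw [ha] at this
  norm_num at this
  exact this

theorem isNotSedentary_of_nu2_ne (h : IsTwoPhaseWalk G T b Δ) (ha : T.card = 2) (hu : u ∈ T)
    {q : ℕ} (hq : Δ = (q : ℤ) ^ 2) (hne : nu2 b ≠ nu2 q) : IsNotSedentary G u := by
  obtain ⟨h1, h2⟩ := h.phases_eq_neg_one hq hne rfl odd_one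
  refine isNotSedentary_of_forall_exists fun ε hε => ⟨_, h.time_pos hq hne rfl one_pos, ?_⟩
  have := h.norm_transition_le_of_near (by omega) hu (ε := ε) (by rw [h1]; simpa using hε.le)
      (by rw [h2]; simpa using hε.le)
  rw [ha] at this
  norm_num at this ⊢
  exact this

theorem hasPGST (h : IsTwoPhaseWalk G T b Δ) (ha : T.card = 2) (hu : u ∈ T) (hv : v ∈ T)
    (huv : u ≠ v) (hb : b = 0 ∨ ¬ IsSquare Δ) : HasPGST G u v := by
  choose τ hτ h1 h2 using fun k : ℕ => h.exists_near hb (Nat.one_div_pos_of_nat (α := ℝ) (n := k)) k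
  refine ⟨τ, tendsto_atTop_mono (fun k => (hτ k).le) tendsto_natCast_atTop_atTop, ?_⟩
  have h3 : Tendsto (fun k : ℕ => 1 - 1 / ((k : ℝ) + 1)) atTop (𝓝 1) := by
    simpa using tendsto_one_div_add_atTop_nhds_zero_nat.const_sub (1 : ℝ)
  exact tendsto_of_tendsto_of_tendsto_of_le_of_le h3 tendsto_const_nhds
    (fun k => (h.one_sub_le_norm_transition_of_near ha hu hv huv (h1 k).le (h2 k).le).1)
    (fun k => (h.one_sub_le_norm_transition_of_near ha hu hv huv (h1 k).le (h2 k).le).2)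

theorem hasPST (h : IsTwoPhaseWalk G T b Δ) (ha : T.card = 2) (hu : u ∈ T) (hv : v ∈ T)
    (huv : u ≠ v) {q : ℕ} (hq : Δ = (q : ℤ) ^ 2) (hne : nu2 b ≠ nu2 q) : HasPST G u v := by
  obtain ⟨h1, h2⟩ := h.phases_eq_neg_one hq hne rfl odd_one
  have := h.one_sub_le_norm_transition_of_near ha hu hv huv (ε := 0) (by rw [h1]; simp)
      (by rw [h2]; simp)
  exact ⟨_, le_antisymm this.2 (by simpa using this.1)⟩

theorem hasPST_of_eq_zero (h : IsTwoPhaseWalk G T b Δ) (ha : T.card = 2) (hu : u ∈ T) (hv : v ∈ T)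
    (huv : u ≠ v) (hb : b = 0) : HasPST G u v := by
  have hR : 0 < √(Δ : ℝ) := Real.sqrt_pos.2 (by exact_mod_cast h.discr_pos)
  have h1 : phase (((b : ℝ) + √Δ) / 2 * (2 * Real.pi / √Δ)) = -1 :=
    (phase_eq_neg_one_iff _).2 ⟨1, odd_one, by rw [hb]; push_cast; field_simp; ring⟩
  have h2 : phase (((b : ℝ) - √Δ) / 2 * (2 * Real.pi / √Δ)) = -1 :=
    (phase_eq_neg_one_iff _).2 ⟨-1, odd_neg_one, by rw [hb]; push_cast; field_simp; ring⟩
  have := h.one_sub_le_norm_transition_of_near ha hu hv huv (ε := 0) (by rw [h1]; simp)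
      (by rw [h2]; simp)
  exact ⟨_, le_antisymm this.2 (by simpa using this.1)⟩

end IsTwoPhaseWalk

end

/-! ### Complete multipartite graphs -/

section

variable {k : ℕ} {N : Fin k → ℕ}

theorem multipartite_adjMatrix (v w : Σ ℓ : Fin k, Fin (N ℓ)) :
    (multipartite N).adjMatrix ℝ v w = if v.1 = w.1 then 0 else 1 := by
  rw [SimpleGraph.adjMatrix_apply]
  have : (multipartite N).Adj v w ↔ v.1 ≠ w.1 := by
    simp [multipartite, SimpleGraph.completeMultipartiteGraph]
  simp only [this, ne_eq, ite_not]

/-- The set of vertices in the parts with index in `I`. -/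
def partsUnion (N : Fin k → ℕ) (I : Finset (Fin k)) : Finset (Σ ℓ : Fin k, Fin (N ℓ)) :=
  Finset.univ.filter fun v => v.1 ∈ I

theorem mem_partsUnion {I : Finset (Fin k)} {v : Σ ℓ : Fin k, Fin (N ℓ)} :
    v ∈ partsUnion N I ↔ v.1 ∈ I := by simp [partsUnion]

theorem card_partsUnion (I : Finset (Fin k)) : (partsUnion N I).card = ∑ ℓ ∈ I, N ℓ := by
  have : partsUnion N I = I.sigma fun _ => Finset.univ := by
    ext v; simp [mem_partsUnion]
  rw [this, Finset.card_sigma]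
  simp

theorem compl_partsUnion (I : Finset (Fin k)) : (partsUnion N I)ᶜ = partsUnion N Iᶜ := by
  ext v; simp [mem_partsUnion]

theorem card_compl_partsUnion (I : Finset (Fin k)) :
    (((partsUnion N I)ᶜ).card : ℝ) = (∑ ℓ, N ℓ : ℕ) - (∑ ℓ ∈ I, N ℓ : ℕ) := by
  rw [compl_partsUnion, card_partsUnion, ← Finset.sum_add_sum_compl I]
  push_cast; ring

theorem compl_partsUnion_nonempty (hN : ∀ ℓ, 1 ≤ N ℓ) {I : Finset (Fin k)}
    (hI : I ≠ Finset.univ) : ((partsUnion N I)ᶜ).Nonempty := by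
  obtain ⟨ℓ, hℓ⟩ : ∃ ℓ, ℓ ∉ I := by
    by_contra! h
    exact hI (Finset.eq_univ_iff_forall.2 h)
  exact ⟨⟨ℓ, ⟨0, hN ℓ⟩⟩, by simpa [mem_partsUnion] using hℓ⟩

/-- The vertices which form parts of their own are pairwise adjacent twins. -/
theorem isTwinSet_singletons {I : Finset (Fin k)} (hI : I.Nonempty) (h1 : ∀ ℓ ∈ I, N ℓ = 1) :
    IsTwinSet (multipartite N) (partsUnion N I) 1 := by
  refine ⟨?_, fun u hu v => ?_⟩
  · obtain ⟨ℓ, hℓ⟩ := hI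
    exact ⟨⟨ℓ, ⟨0, by rw [h1 ℓ hℓ]; exact one_pos⟩⟩, mem_partsUnion.2 hℓ⟩
  · rw [multipartite_adjMatrix]
    rw [mem_partsUnion] at hu
    have hvu : v.1 = u.1 ↔ v = u := by
      refine ⟨fun h => ?_, fun h => h ▸ rfl⟩
      obtain ⟨ℓ, x⟩ := u
      obtain ⟨ℓ', y⟩ := v
      obtain rfl : ℓ' = ℓ := h
      have : Subsingleton (Fin (N ℓ')) := by rw [h1 ℓ' hu]; infer_instance
      rw [Subsingleton.elim x y]
    by_cases hv : v ∈ partsUnion N I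
    · simp only [hv, if_true, hvu]
    · have : v.1 ≠ u.1 := fun h => hv (mem_partsUnion.2 (h ▸ hu))
      simp only [hv, if_false, this]

theorem isTwinSet_part (hN : ∀ ℓ, 1 ≤ N ℓ) (ℓ : Fin k) :
    IsTwinSet (multipartite N) (partsUnion N {ℓ}) 0 := by
  refine ⟨⟨⟨ℓ, ⟨0, hN ℓ⟩⟩, by simp [mem_partsUnion]⟩, fun u hu v => ?_⟩
  rw [multipartite_adjMatrix]
  rw [mem_partsUnion, Finset.mem_singleton] at hu
  simp only [mem_partsUnion, Finset.mem_singleton, hu, ite_self]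

theorem isRegularOutside {I : Finset (Fin k)} {m : ℕ} (hm : ∀ r ∉ I, N r = m) :
    IsRegularOutside (multipartite N) (partsUnion N I)
      ((∑ ℓ, N ℓ : ℕ) - (∑ ℓ ∈ I, N ℓ : ℕ) - m) := by
  intro v hv
  rw [mem_partsUnion] at hv
  have h1 : ∀ w ∈ (partsUnion N I)ᶜ, (multipartite N).adjMatrix ℝ v w
      = 1 - if w ∈ partsUnion N {v.1} then 1 else 0 := by
    intro w _
    rw [multipartite_adjMatrix]
    simp only [mem_partsUnion, Finset.mem_singleton, eq_comm (a := v.1)]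
    split_ifs <;> simp
  rw [Finset.sum_congr rfl h1, Finset.sum_sub_distrib, Finset.sum_const, nsmul_one,
    card_compl_partsUnion, ← Finset.sum_filter, Finset.sum_const, nsmul_one]
  have h2 : (partsUnion N I)ᶜ.filter (· ∈ partsUnion N {v.1}) = partsUnion N {v.1} := by
    ext w
    simp only [compl_partsUnion, Finset.mem_filter, mem_partsUnion, Finset.mem_singleton,
      Finset.mem_compl, and_iff_right_iff_imp]
    rintro h
    rwa [h]
  rw [h2, card_partsUnion, Finset.sum_singleton, hm v.1 hv]

theorem card_partsUnion_singletons {I : Finset (Fin k)} (h1 : ∀ ℓ ∈ I, N ℓ = 1) :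
    ∑ ℓ ∈ I, N ℓ = I.card := by
  rw [Finset.sum_congr rfl h1]; simp

theorem isTwoPhaseWalk_singletons (hN : ∀ ℓ, 1 ≤ N ℓ) {I : Finset (Fin k)} (hI : I.Nonempty)
    (h1 : ∀ ℓ ∈ I, N ℓ = 1) (hI' : I ≠ Finset.univ) {m : ℕ} (hm : ∀ r ∉ I, N r = m) {n : ℕ}
    (hn : n = ∑ ℓ, N ℓ) {Δ : ℤ}
    (hΔ : Δ = ((n : ℤ) - m - 2 * I.card + 1) ^ 2 + 4 * I.card * ((n : ℤ) - I.card)) :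
    IsTwoPhaseWalk (multipartite N) (partsUnion N I) ((n : ℤ) - m + 1) Δ := by
  refine (isTwinSet_singletons hI h1).isTwoPhaseWalk (isRegularOutside hm)
    (compl_partsUnion_nonempty hN hI') ?_ ?_ ?_
  · rw [card_partsUnion, card_partsUnion_singletons h1, ← hn]
    push_cast; ring
  · rw [card_compl_partsUnion, card_partsUnion, card_partsUnion_singletons h1, ← hn, hΔ]
    push_cast; ring
  · refine ⟨2 * I.card * (1 - m), ?_⟩
    rw [hΔ]; ring

theorem isTwoPhaseWalk_part (hN : ∀ ℓ, 1 ≤ N ℓ) (hk : 2 ≤ k) (ℓ : Fin k) {m : ℕ}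
    (hm : ∀ r, r ≠ ℓ → N r = m) {n : ℕ} (hn : n = ∑ ℓ, N ℓ) {Δ : ℤ}
    (hΔ : Δ = ((n : ℤ) - N ℓ - m) ^ 2 + 4 * N ℓ * ((n : ℤ) - N ℓ)) :
    IsTwoPhaseWalk (multipartite N) (partsUnion N {ℓ}) ((n : ℤ) - N ℓ - m) Δ := by
  have hI' : ({ℓ} : Finset (Fin k)) ≠ Finset.univ := by
    intro h
    have := congrArg Finset.card h
    rw [Finset.card_singleton, Finset.card_univ, Fintype.card_fin] at this
    omega
  refine (isTwinSet_part hN ℓ).isTwoPhaseWalk (isRegularOutside (m := m) fun r hr =>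
    hm r (by simpa using hr)) (compl_partsUnion_nonempty hN hI') ?_ ?_ ?_
  · rw [card_partsUnion, Finset.sum_singleton, ← hn]
    push_cast; ring
  · rw [card_compl_partsUnion, card_partsUnion, Finset.sum_singleton, ← hn, hΔ]
    push_cast; ring
  · refine ⟨-(2 * N ℓ * ((n : ℤ) - N ℓ)), ?_⟩
    rw [hΔ]; ring

/-- A vertex in another part is adjacent to the other vertices of the part of `u`, unlike `u`. -/
theorem isTwin_same_part {u v : Σ ℓ : Fin k, Fin (N ℓ)} (hu : 2 ≤ N u.1)
    (h : IsTwin (multipartite N) u v) : u.1 = v.1 := by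
  by_contra hne
  have hadj : ∀ x y : Σ ℓ : Fin k, Fin (N ℓ), (multipartite N).Adj x y ↔ x.1 ≠ y.1 := by
    intro x y
    simp [multipartite, SimpleGraph.completeMultipartiteGraph]
  have : Nontrivial (Fin (N u.1)) := Fin.nontrivial_iff_two_le.2 hu
  obtain ⟨x, hx⟩ := exists_ne u.2
  have hw : (⟨u.1, x⟩ : Σ ℓ : Fin k, Fin (N ℓ)) ∈
      (multipartite N).neighborSet v \ {u, v} := by
    refine ⟨(hadj _ _).2 fun h => hne h.symm, ?_⟩
    rintro (h | h)
    · apply hx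
      obtain ⟨ℓ, y⟩ := u
      simpa using h
    · exact hne (by rw [← Set.mem_singleton_iff.1 h])
  rw [← h.2] at hw
  exact (hadj _ _).1 hw.1 rfl

end

/-! ### Parts of size two next to singletons -/

section

theorem norm_pow_sub_one_le {z : ℂ} (hz : ‖z‖ = 1) (m : ℕ) : ‖z ^ m - 1‖ ≤ m * ‖z - 1‖ := by
  induction m with
  | zero => simp
  | succ m ih =>
    have : z ^ (m + 1) - 1 = z * (z ^ m - 1) + (z - 1) := by ring
    rw [this]
    refine (norm_add_le _ _).trans ?_
    rw [norm_mul, hz, one_mul]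
    push_cast
    linarith

theorem norm_phase_neg_add_one (x : ℝ) : ‖phase (-x) + 1‖ = ‖phase x + 1‖ := by
  have h : phase (-x) * phase x = 1 := by rw [← phase_add, neg_add_cancel, phase_zero]
  have : phase (-x) + 1 = phase (-x) * (phase x + 1) := by rw [mul_add, h]; ring
  rw [this, norm_mul, norm_phase, one_mul]

theorem phase_natCast_mul (m : ℕ) (x : ℝ) : phase (m * x) = phase x ^ m := by
  unfold phase
  rw [← Complex.exp_nat_mul]
  congr 1; push_cast; ring

theorem eq_neg_one_of_norm_eq_one {z : ℂ} (hz : ‖z‖ = 1) (h : z.re ≤ -1) : z = -1 := by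
  have h1 : z.re = -1 := le_antisymm h (by
    have := (Complex.abs_re_le_norm z).trans hz.le
    exact (abs_le.1 this).1)
  have h2 := Complex.sq_norm z
  rw [hz, normSq_apply, h1] at h2
  have h3 : z.im = 0 := by nlinarith
  exact Complex.ext (by simp [h1]) (by simp [h3])

/-- A multiplicative relation between three phases which excludes that all three are `-1` keeps
their convex combinations away from `-1`. -/
theorem exists_pos_le_norm_one_add {w₀ w₁ w₂ : ℝ} (h₀ : 0 < w₀) (h₁ : 0 < w₁) (h₂ : 0 < w₂)
    (hw : w₀ + w₁ + w₂ = 1) (i : ℕ) {j : ℕ} (hj : Odd j) :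
    ∃ δ > 0, ∀ x y z : ℂ, ‖x‖ = 1 → ‖y‖ = 1 → ‖z‖ = 1 → (y * z) ^ i * x ^ j = 1 →
      δ ≤ ‖1 + (w₀ * x + w₁ * y + w₂ * z)‖ := by
  let S : Set (ℂ × ℂ × ℂ) := Metric.sphere 0 1 ×ˢ Metric.sphere 0 1 ×ˢ Metric.sphere 0 1
  let K : Set (ℂ × ℂ × ℂ) := S ∩ {c | (c.2.1 * c.2.2) ^ i * c.1 ^ j = 1}
  have hS : IsCompact S :=
    (isCompact_sphere _ _).prod ((isCompact_sphere _ _).prod (isCompact_sphere _ _))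
  have hK : IsCompact K := hS.inter_right (isClosed_eq (by fun_prop) continuous_const)
  let f : ℂ × ℂ × ℂ → ℝ := fun c => ‖1 + (w₀ * c.1 + w₁ * c.2.1 + w₂ * c.2.2)‖
  have hf : Continuous f := by fun_prop
  have hmem : ∀ x y z : ℂ, ‖x‖ = 1 → ‖y‖ = 1 → ‖z‖ = 1 → (y * z) ^ i * x ^ j = 1 →
      (x, y, z) ∈ K := by
    intro x y z hx hy hz h
    exact ⟨⟨by simpa using hx, by simpa using hy, by simpa using hz⟩, h⟩
  rcases K.eq_empty_or_nonempty with hE | hne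
  · refine ⟨1, one_pos, fun x y z hx hy hz h => ?_⟩
    have := hmem x y z hx hy hz h
    rw [hE] at this
    exact this.elim
  · obtain ⟨⟨x, y, z⟩, ⟨⟨hx, hy, hz⟩, hrel⟩, hmin⟩ := hK.exists_isMinOn hne hf.continuousOn
    simp only [mem_sphere_iff_norm, sub_zero] at hx hy hz
    refine ⟨f (x, y, z), ?_, fun x' y' z' hx' hy' hz' h' => hmin (hmem x' y' z' hx' hy' hz' h')⟩
    refine lt_of_le_of_ne (norm_nonneg _) fun h0 => ?_
    have h1 : (1 : ℂ) + (w₀ * x + w₁ * y + w₂ * z) = 0 := norm_eq_zero.1 h0.symm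
    have hre := congrArg Complex.re h1
    simp only [add_re, re_ofReal_mul, one_re, zero_re] at hre
    have hb : ∀ c : ℂ, ‖c‖ = 1 → -1 ≤ c.re := fun c hc =>
      (abs_le.1 ((Complex.abs_re_le_norm c).trans hc.le)).1
    have bx := hb x hx
    have bz := hb z hz
    have b_y := hb y hy
    have ex : x = -1 := eq_neg_one_of_norm_eq_one hx (by by_contra hc; nlinarith)
    have ey : y = -1 := eq_neg_one_of_norm_eq_one hy (by by_contra hc; nlinarith)
    have ez : z = -1 := eq_neg_one_of_norm_eq_one hz (by by_contra hc; nlinarith)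
    simp only [Set.mem_ofPred_eq, ex, ey, ez, hj.neg_one_pow] at hrel
    norm_num at hrel

variable {k : ℕ} {N : Fin k → ℕ}

/-- The walk on a part `{u, u'}` of size two, all other parts outside `I` having size two as well:
the eigenvalues involved are `0`, `-2` and `(n - 3 ± R) / 2`. -/
theorem transition_apply_pair (hN : ∀ ℓ, 1 ≤ N ℓ) {I : Finset (Fin k)} (hI : I.Nonempty)
    (h1 : ∀ ℓ ∈ I, N ℓ = 1) (h2 : ∀ r ∉ I, N r = 2) {n : ℕ} (hn : n = ∑ ℓ, N ℓ) {s R : ℝ}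
    (hs : s = n - I.card) (hs0 : 0 < s) (hR : 0 < R) (hR2 : R ^ 2 = ((n : ℝ) - 1) ^ 2 + 4 * I.card)
    {u v : Σ ℓ : Fin k, Fin (N ℓ)} (hu : u.1 ∉ I) (huv : v.1 = u.1) (t : ℝ) :
    transition (multipartite N) t v u = (if v = u then 1 else 0) - 1 / 2 + 1 / 2 *
      (((1 - 2 / s : ℝ) : ℂ) * phase (-2 * t) + ((2 / s : ℝ) : ℂ) *
        phaseMix ((1 + (s - I.card - 1) / R) / 2) (((n : ℝ) - 3 + R) / 2 * t)
          (((n : ℝ) - 3 - R) / 2 * t)) := by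
  set T := partsUnion N I with hTdef
  set P := partsUnion N {u.1} with hPdef
  have hT : IsTwinSet (multipartite N) T 1 := isTwinSet_singletons hI h1
  have hP : IsTwinSet (multipartite N) P 0 := isTwinSet_part hN u.1
  have hPc : (P.card : ℝ) = 2 := by
    rw [card_partsUnion, Finset.sum_singleton, h2 _ hu]; norm_num
  have hTc : (T.card : ℝ) = I.card := by
    rw [card_partsUnion, card_partsUnion_singletons h1]
  have hSc : ((Tᶜ).card : ℝ) = s := by
    rw [card_compl_partsUnion, card_partsUnion_singletons h1, ← hn, hs]
  have hreg : IsRegularOutside (multipartite N) T (s - 2) := by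
    have := isRegularOutside h2
    rw [card_partsUnion_singletons h1, ← hn] at this
    rw [hs]; exact_mod_cast this
  have huP : u ∈ P := by simp [hPdef, mem_partsUnion]
  have hvP : v ∈ P := by simp [hPdef, mem_partsUnion, huv]
  have hPT : ∀ w ∈ P, w ∉ T := by
    intro w hw
    simp only [hPdef, hTdef, mem_partsUnion, Finset.mem_singleton] at hw ⊢
    rwa [hw]
  set a : ℝ := (I.card : ℝ) with ha
  have hna : (n : ℝ) = s + a := by rw [hs]; ring
  let lam : Fin 4 → ℝ := ![0, -2, ((n : ℝ) - 3 + R) / 2, ((n : ℝ) - 3 - R) / 2]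
  let y : Fin 4 → (Σ ℓ : Fin k, Fin (N ℓ)) → ℝ := ![twinDeviation P u,
    (fun w => if w ∈ P then 1 / 2 else 0) - (fun w => if w ∈ T then 0 else 1 / s),
    fun w => if w ∈ T then 1 / R else s⁻¹ * ((1 + (s - a - 1) / R) / 2),
    fun w => if w ∈ T then -(1 / R) else s⁻¹ * ((1 - (s - a - 1) / R) / 2)]
  have hblock : ∀ α β μ : ℝ, (a - 1) * α + s * β = μ * α → a * α + (s - 2) * β = μ * β →
      ((multipartite N).adjMatrix ℝ).mulVec (fun w => if w ∈ T then α else β)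
        = μ • fun w => if w ∈ T then α else β := by
    intro α β μ e1 e2
    funext w
    rw [hT.mulVec_block, Pi.smul_apply, smul_eq_mul, hTc, hSc, one_mul]
    split_ifs with hw
    · exact e1
    · rw [hreg w hw, e2]
  have hy : ∀ j, ((multipartite N).adjMatrix ℝ).mulVec (y j) = lam j • y j := by
    intro j
    fin_cases j
    · have := hP.mulVec_twinDeviation huP
      rw [neg_zero] at this
      exact this
    · change ((multipartite N).adjMatrix ℝ).mulVec ((fun w => if w ∈ P then 1 / 2 else 0)
          - (fun w => if w ∈ T then 0 else 1 / s)) = (-2 : ℝ) • _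
      rw [Matrix.mulVec_sub]
      funext w
      rw [Pi.sub_apply, hP.mulVec_block, hT.mulVec_block, hPc, hTc, hSc]
      change _ = -2 * ((if w ∈ P then 1 / 2 else 0) - if w ∈ T then 0 else 1 / s)
      by_cases hwP : w ∈ P
      · have hwT := hPT w hwP
        simp only [hwP, hwT, if_true, if_false, hreg w hwT]
        field_simp; ring
      · by_cases hwT : w ∈ T
        · simp only [hwP, hwT, if_true, if_false]
          field_simp; ring
        · simp only [hwP, hwT, if_false, hreg w hwT]
          field_simp; ring
    · refine hblock _ _ (((n : ℝ) - 3 + R) / 2) ?_ ?_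
      · rw [hna]; field_simp; ring
      · rw [hna] at hR2 ⊢; field_simp; linear_combination -hR2
    · refine hblock _ _ (((n : ℝ) - 3 - R) / 2) ?_ ?_
      · rw [hna]; field_simp; ring
      · rw [hna] at hR2 ⊢; field_simp; linear_combination hR2
  have hsum : ∀ w, ∑ j, y j w = if w = u then 1 else 0 := by
    intro w
    rw [Fin.sum_univ_four]
    change ((if w = u then 1 else 0) - if w ∈ P then (P.card : ℝ)⁻¹ else 0)
      + ((if w ∈ P then 1 / 2 else 0) - if w ∈ T then 0 else 1 / s)
      + (if w ∈ T then 1 / R else s⁻¹ * ((1 + (s - a - 1) / R) / 2))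
      + (if w ∈ T then -(1 / R) else s⁻¹ * ((1 - (s - a - 1) / R) / 2)) = _
    rw [hPc]
    by_cases hwP : w ∈ P <;> by_cases hwT : w ∈ T <;>
      simp only [hwP, hwT, if_true, if_false] <;> ring
  have hvT := hPT v hvP
  rw [transition_apply_of_eigenvectors _ lam y hy hsum, Fin.sum_univ_four]
  change phase (0 * t) * (((if v = u then 1 else 0) - if v ∈ P then (P.card : ℝ)⁻¹ else 0 : ℝ) : ℂ)
    + phase (-2 * t) * (((if v ∈ P then 1 / 2 else 0) - if v ∈ T then 0 else 1 / s : ℝ) : ℂ)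
    + phase (((n : ℝ) - 3 + R) / 2 * t) *
      ((if v ∈ T then 1 / R else s⁻¹ * ((1 + (s - a - 1) / R) / 2) : ℝ) : ℂ)
    + phase (((n : ℝ) - 3 - R) / 2 * t) *
      ((if v ∈ T then -(1 / R) else s⁻¹ * ((1 - (s - a - 1) / R) / 2) : ℝ) : ℂ) = _
  rw [if_pos hvP, if_pos hvP, if_neg hvT, if_neg hvT, if_neg hvT, hPc, zero_mul, phase_zero,
    phaseMix]
  have hite : (((if v = u then (1 : ℝ) else 0) : ℝ) : ℂ) = if v = u then 1 else 0 := by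
    split_ifs <;> simp
  push_cast
  rw [hite]
  ring

/-- `Δ` lies strictly between `(n - 1) ^ 2` and `(n + 1) ^ 2`, and has the wrong parity to be
`n ^ 2`. -/
theorem discr_ne_sq {n a : ℕ} (ha : 1 ≤ a) (han : a + 4 ≤ n) {q : ℤ} :
    ((n : ℤ) - 1) ^ 2 + 4 * a ≠ q ^ 2 := by
  intro h
  have ha' : (1 : ℤ) ≤ a := by exact_mod_cast ha
  have han' : (a : ℤ) + 4 ≤ n := by exact_mod_cast han
  rw [← sq_abs q] at h
  have hq := abs_nonneg q
  generalize |q| = r at h hq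
  have h1 : (n : ℤ) - 1 < r := by nlinarith
  have h2 : r < n + 1 := by nlinarith
  obtain rfl : r = n := by omega
  have : 4 * (a : ℤ) = 2 * n - 1 := by linear_combination h
  omega

/-- The data of the walk on a part of size two: `1 / 2 * (±1 + ψ t)` with `ψ` a convex combination
of the phases of `-2` and `(n - 3 ± R) / 2`. -/
theorem exists_transition_pair (hN : ∀ ℓ, 1 ≤ N ℓ) {I : Finset (Fin k)} (hI : I.Nonempty)
    (h1 : ∀ ℓ ∈ I, N ℓ = 1) (h2 : ∀ r ∉ I, N r = 2) {n : ℕ} (hn : n = ∑ ℓ, N ℓ)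
    (hIn : I.card + 4 ≤ n) {Δ : ℤ} (hΔ : Δ = ((n : ℤ) - 1) ^ 2 + 4 * I.card) :
    ∃ w₀ w₁ w₂ : ℝ, 0 < w₀ ∧ 0 < w₁ ∧ 0 < w₂ ∧ w₀ + w₁ + w₂ = 1 ∧
      ∀ u v : Σ ℓ : Fin k, Fin (N ℓ), u.1 ∉ I → v.1 = u.1 → ∀ t,
        transition (multipartite N) t v u = (if v = u then 1 else 0) - 1 / 2 + 1 / 2 *
          (w₀ * phase (-2 * t) + w₁ * phase (((n : ℝ) - 3 + √Δ) / 2 * t)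
            + w₂ * phase (((n : ℝ) - 3 - √Δ) / 2 * t)) := by
  have ha : (1 : ℝ) ≤ I.card := by exact_mod_cast hI.card_pos
  have hIn' : (I.card : ℝ) + 4 ≤ n := by exact_mod_cast hIn
  set s : ℝ := n - I.card with hs
  have hs4 : 4 ≤ s := by linarith
  have hΔ' : (Δ : ℝ) = ((n : ℝ) - 1) ^ 2 + 4 * I.card := by rw [hΔ]; push_cast; ring
  have hΔ0 : (0 : ℝ) < Δ := by rw [hΔ']; positivity
  have hR : 0 < √(Δ : ℝ) := Real.sqrt_pos.2 hΔ0
  have hR2 : √(Δ : ℝ) ^ 2 = ((n : ℝ) - 1) ^ 2 + 4 * I.card := by rw [Real.sq_sqrt hΔ0.le, hΔ']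
  obtain ⟨hp0, hp1⟩ := quotient_weight_mem_Ioo (x := s - I.card - 1) (y := 4 * I.card * s) hR
    (by rw [hR2, hs]; ring) (by positivity)
  set p := (1 + (s - I.card - 1) / √(Δ : ℝ)) / 2 with hp
  have h2s : 0 < 2 / s := by positivity
  have h2s' : 2 / s < 1 := by rw [div_lt_one (by linarith)]; linarith
  refine ⟨1 - 2 / s, 2 / s * p, 2 / s * (1 - p), by linarith, by positivity,
    mul_pos h2s (by linarith), by ring, fun u v hu huv t => ?_⟩
  rw [transition_apply_pair hN hI h1 h2 hn hs (by linarith) hR hR2 hu huv, ← hp, phaseMix]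
  push_cast
  ring

theorem norm_convex_combination_le {w₀ w₁ w₂ : ℝ} (h₀ : 0 < w₀) (h₁ : 0 < w₁) (h₂ : 0 < w₂)
    {x y z : ℂ} {ε : ℝ} (hx : ‖x‖ ≤ ε) (hy : ‖y‖ ≤ ε) (hz : ‖z‖ ≤ ε) :
    ‖w₀ * x + w₁ * y + w₂ * z‖ ≤ (w₀ + w₁ + w₂) * ε := by
  refine (norm_add₃_le).trans ?_
  rw [norm_mul, norm_mul, norm_mul, norm_real, norm_real, norm_real, Real.norm_of_nonneg h₀.le,
    Real.norm_of_nonneg h₁.le, Real.norm_of_nonneg h₂.le]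
  nlinarith

section Pair

variable {I : Finset (Fin k)} {n : ℕ} {Δ : ℤ}

/-- If `n ≢ 3 (mod 4)`, the relation `λ₊ + λ₋ = n - 3` between the eigenvalues keeps the three
phases from approaching `-1` simultaneously. -/
theorem exists_pos_le_norm_transition_pair (hN : ∀ ℓ, 1 ≤ N ℓ) (hI : I.Nonempty)
    (h1 : ∀ ℓ ∈ I, N ℓ = 1) (h2 : ∀ r ∉ I, N r = 2) (hn : n = ∑ ℓ, N ℓ)
    (hIn : I.card + 4 ≤ n) (hΔ : Δ = ((n : ℤ) - 1) ^ 2 + 4 * I.card) (hn3 : n % 4 ≠ 3)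
    {u : Σ ℓ : Fin k, Fin (N ℓ)} (hu : u.1 ∉ I) :
    ∃ δ > 0, ∀ t, δ ≤ ‖transition (multipartite N) t u u‖ ∧
      ∀ v : Σ ℓ : Fin k, Fin (N ℓ), v.1 = u.1 → v ≠ u →
        ‖transition (multipartite N) t v u‖ ^ 2 ≤ 1 - δ ^ 2 := by
  obtain ⟨w₀, w₁, w₂, hw₀, hw₁, hw₂, hw, hU⟩ := exists_transition_pair hN hI h1 h2 hn hIn hΔ
  -- `(e^{itλ₊} e^{itλ₋}) ^ i = e^{it i (n - 3)} = (e^{2it}) ^ j`, where `j` can be chosen odd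
  obtain ⟨i, j, hij, hj⟩ : ∃ i j : ℕ, i * (n - 3) = 2 * j ∧ Odd j := by
    rcases Nat.even_or_odd n with he | ho
    · exact ⟨2, n - 3, rfl, Nat.Even.sub_odd (by omega) he (by decide)⟩
    · obtain ⟨c, hc⟩ := ho
      refine ⟨1, c - 1, by omega, ?_⟩
      rw [Nat.odd_iff]; omega
  obtain ⟨δ, hδ, hδ'⟩ := exists_pos_le_norm_one_add hw₀ hw₁ hw₂ hw i hj
  refine ⟨δ / 2, by positivity, fun t => ?_⟩
  have hrel : (phase (((n : ℝ) - 3 + √Δ) / 2 * t) * phase (((n : ℝ) - 3 - √Δ) / 2 * t)) ^ i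
      * phase (-2 * t) ^ j = 1 := by
    rw [← phase_add, ← phase_natCast_mul, ← phase_natCast_mul, ← phase_add, ← phase_zero]
    congr 1
    have hij' : (i : ℝ) * ((n : ℝ) - 3) = 2 * j := by
      have h3 : ((n - 3 : ℕ) : ℝ) = n - 3 := by rw [Nat.cast_sub (by omega)]; norm_num
      rw [← h3]
      exact_mod_cast hij
    linear_combination t * hij'
  have hlow := hδ' _ _ _ (norm_phase _) (norm_phase _) (norm_phase _) hrel
  have hle := norm_convex_combination_le hw₀ hw₁ hw₂ (norm_phase (-2 * t)).le
    (norm_phase (((n : ℝ) - 3 + √Δ) / 2 * t)).le (norm_phase (((n : ℝ) - 3 - √Δ) / 2 * t)).le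
  rw [hw, one_mul] at hle
  have hUt := fun v hv => hU u v hu hv t
  set ψ : ℂ := w₀ * phase (-2 * t) + w₁ * phase (((n : ℝ) - 3 + √Δ) / 2 * t)
    + w₂ * phase (((n : ℝ) - 3 - √Δ) / 2 * t)
  have h12 : ‖(1 / 2 : ℂ)‖ = 1 / 2 := by simp
  constructor
  · rw [hUt u rfl, if_pos rfl, show (1 : ℂ) - 1 / 2 + 1 / 2 * ψ = 1 / 2 * (1 + ψ) by ring,
      norm_mul, h12]
    linarith
  · intro v hv hne
    rw [hUt v hv, if_neg hne, show (0 : ℂ) - 1 / 2 + 1 / 2 * ψ = 1 / 2 * (ψ - 1) by ring,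
      norm_mul, h12]
    -- `|1 + ψ| ^ 2 + |1 - ψ| ^ 2 = 2 (1 + |ψ| ^ 2) ≤ 4`
    have hpar := parallelogram_law_with_norm ℝ ψ 1
    rw [norm_one, add_comm ψ 1] at hpar
    have h3 : δ ^ 2 ≤ ‖1 + ψ‖ ^ 2 := pow_le_pow_left₀ hδ.le hlow 2
    have h4 : ‖ψ‖ ^ 2 ≤ 1 := pow_le_one₀ (norm_nonneg _) hle
    nlinarith

theorem hasPGST_pair (hN : ∀ ℓ, 1 ≤ N ℓ) (hI : I.Nonempty)
    (h1 : ∀ ℓ ∈ I, N ℓ = 1) (h2 : ∀ r ∉ I, N r = 2) (hn : n = ∑ ℓ, N ℓ)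
    (hIn : I.card + 4 ≤ n) (hΔ : Δ = ((n : ℤ) - 1) ^ 2 + 4 * I.card) (hn3 : n % 4 = 3)
    (hsq : ¬ IsSquare Δ) {u v : Σ ℓ : Fin k, Fin (N ℓ)} (hu : u.1 ∉ I) (huv : v.1 = u.1)
    (hne : v ≠ u) : HasPGST (multipartite N) v u := by
  obtain ⟨w₀, w₁, w₂, hw₀, hw₁, hw₂, hw, hU⟩ := exists_transition_pair hN hI h1 h2 hn hIn hΔ
  have hΔ0 : (0 : ℝ) < Δ := by
    have hn1 : (1 : ℝ) ≤ I.card := by exact_mod_cast hI.card_pos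
    rw [hΔ]; push_cast; positivity
  set R := √(Δ : ℝ) with hRdef
  have hR : 0 < R := Real.sqrt_pos.2 hΔ0
  have hirr : Irrational R := irrational_of_sq_eq hR (Real.sq_sqrt hΔ0.le) hsq
  obtain ⟨c, hc⟩ : ∃ c : ℕ, n = 4 * c + 3 := ⟨n / 4, by omega⟩
  have hnr : (n : ℝ) - 3 = 4 * c := by rw [hc]; push_cast; ring
  -- the third phase follows from these two, because `n - 3` is a multiple of `4`
  have hind : LinearIndependent ℚ ![(2 : ℝ), ((n : ℝ) - 3 + R) / 2] := by
    rw [LinearIndependent.pair_iff]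
    intro x y h
    rw [Rat.smul_def, Rat.smul_def] at h
    have hy : y = 0 := by
      by_contra hy
      have hy' : (y : ℝ) ≠ 0 := by exact_mod_cast hy
      refine hirr ⟨-(4 * x + 4 * c * y) / y, ?_⟩
      push_cast
      rw [div_eq_iff hy']
      rw [hnr] at h
      linear_combination -2 * h
    subst hy
    refine ⟨?_, rfl⟩
    have : (x : ℝ) = 0 := by simpa using h
    exact_mod_cast this
  have hnear : ∀ ε > 0, ∀ T₀ : ℝ, ∃ t > T₀, 1 - (2 * c + 1) * ε ≤ ‖transition (multipartite N) t v u‖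
      ∧ ‖transition (multipartite N) t v u‖ ≤ 1 := by
    intro ε hε T₀
    obtain ⟨t, ht, hi⟩ := exists_forall_phase_near_neg_one _ hind T₀ hε
    have e0 : ‖phase (2 * t) + 1‖ < ε := hi 0
    have e1 : ‖phase (((n : ℝ) - 3 + R) / 2 * t) + 1‖ < ε := hi 1
    refine ⟨t, ht, ?_⟩
    have hc0 : (0 : ℝ) ≤ c := Nat.cast_nonneg c
    have f0 : ‖phase (-2 * t) + 1‖ ≤ (2 * c + 1) * ε := by
      rw [neg_mul, norm_phase_neg_add_one]; nlinarith
    have f1 : ‖phase (((n : ℝ) - 3 + R) / 2 * t) + 1‖ ≤ (2 * c + 1) * ε := by nlinarith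
    have f2 : ‖phase (((n : ℝ) - 3 - R) / 2 * t) + 1‖ ≤ (2 * c + 1) * ε := by
      have hsplit : phase (((n : ℝ) - 3 - R) / 2 * t)
          = (-phase (2 * t)) ^ (2 * c) * phase (-(((n : ℝ) - 3 + R) / 2 * t)) := by
        rw [(even_two_mul c).neg_pow, ← phase_natCast_mul, ← phase_add]
        congr 1
        push_cast
        linear_combination t * hnr
      have hb := norm_pow_sub_one_le (z := -phase (2 * t)) (by rw [norm_neg, norm_phase]) (2 * c)
      have hb' : ‖-phase (2 * t) - 1‖ = ‖phase (2 * t) + 1‖ := by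
        rw [← norm_neg]; congr 1; ring
      rw [hb'] at hb
      rw [← norm_phase_neg_add_one] at e1
      rw [hsplit]
      set z := phase (-(((n : ℝ) - 3 + R) / 2 * t)) with hz
      have hz1 : ‖z‖ = 1 := norm_phase _
      rw [show (-phase (2 * t)) ^ (2 * c) * z + 1 = ((-phase (2 * t)) ^ (2 * c) - 1) * z + (z + 1)
        by ring]
      refine (norm_add_le _ _).trans ?_
      rw [norm_mul, hz1, mul_one]
      push_cast at hb
      nlinarith
    have hcl := norm_convex_combination_le hw₀ hw₁ hw₂ f0 f1 f2
    have hle := norm_convex_combination_le hw₀ hw₁ hw₂ (norm_phase (-2 * t)).le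
      (norm_phase (((n : ℝ) - 3 + R) / 2 * t)).le (norm_phase (((n : ℝ) - 3 - R) / 2 * t)).le
    rw [hw, one_mul] at hle hcl
    rw [hU u v hu huv, if_neg hne]
    set ψ : ℂ := w₀ * phase (-2 * t) + w₁ * phase (((n : ℝ) - 3 + R) / 2 * t)
      + w₂ * phase (((n : ℝ) - 3 - R) / 2 * t) with hψ
    have hw' : (w₀ : ℂ) + w₁ + w₂ = 1 := by exact_mod_cast hw
    have hψ1 : ‖ψ + 1‖ ≤ (2 * c + 1) * ε := by
      refine le_trans (le_of_eq ?_) hcl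
      congr 1
      rw [hψ]; linear_combination -hw'
    have h12 : ‖(1 / 2 : ℂ)‖ = 1 / 2 := by simp
    rw [show (0 : ℂ) - 1 / 2 + 1 / 2 * ψ = 1 / 2 * (ψ - 1) by ring, norm_mul, h12]
    have h6 : ‖ψ - 1‖ ≤ 2 := (norm_sub_le _ _).trans (by rw [norm_one]; linarith)
    have h7 : (2 : ℝ) ≤ ‖ψ + 1‖ + ‖ψ - 1‖ := by
      have := norm_sub_le (ψ + 1) (ψ - 1)
      rw [show ψ + 1 - (ψ - 1) = 2 by ring] at this
      simpa using this
    have h8 : 0 ≤ (2 * c + 1) * ε := by positivity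
    constructor <;> linarith
  choose τ hτ h3 h4 using fun j : ℕ => hnear (1 / ((j : ℝ) + 1)) (by positivity) j
  refine ⟨τ, tendsto_atTop_mono (fun j => (hτ j).le) tendsto_natCast_atTop_atTop, ?_⟩
  have h5 : Tendsto (fun j : ℕ => 1 - (2 * c + 1) * (1 / ((j : ℝ) + 1))) atTop (𝓝 1) := by
    simpa using (tendsto_one_div_add_atTop_nhds_zero_nat.const_mul (2 * (c : ℝ) + 1)).const_sub
      (1 : ℝ)
  exact tendsto_of_tendsto_of_tendsto_of_le_of_le h5 tendsto_const_nhds h3 h4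

theorem not_hasPGST_pair (hN : ∀ ℓ, 1 ≤ N ℓ) (hI : I.Nonempty)
    (h1 : ∀ ℓ ∈ I, N ℓ = 1) (h2 : ∀ r ∉ I, N r = 2) (hn : n = ∑ ℓ, N ℓ)
    (hIn : I.card + 4 ≤ n) (hΔ : Δ = ((n : ℤ) - 1) ^ 2 + 4 * I.card) (hn3 : n % 4 ≠ 3)
    {u v : Σ ℓ : Fin k, Fin (N ℓ)} (hu : u.1 ∉ I) (huv : v.1 = u.1) (hne : v ≠ u) :
    ¬ HasPGST (multipartite N) v u := by
  rintro ⟨τ, -, hτ⟩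
  obtain ⟨δ, hδ, h⟩ := exists_pos_le_norm_transition_pair hN hI h1 h2 hn hIn hΔ hn3 hu
  have := le_of_tendsto (hτ.pow 2) (Eventually.of_forall fun j => (h (τ j)).2 v huv hne)
  nlinarith [pow_pos hδ 2]

end Pair

end

/-! ### A trigonometric inequality -/

section Trigonometry

theorem sin_sq_natCast_mul_reduce (j : ℕ) (k : ℤ) (α : ℝ) :
    Real.sin (j * |α - k * Real.pi|) ^ 2 = Real.sin (j * α) ^ 2 := by
  have h1 : Real.sin (j * (α - k * Real.pi)) ^ 2 = Real.sin (j * α) ^ 2 := by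
    have : (j : ℝ) * α = j * (α - k * Real.pi) + (j * k : ℤ) * Real.pi := by push_cast; ring
    rw [this, Real.sin_add_int_mul_pi, mul_pow, ← zpow_natCast ((-1 : ℝ) ^ (j * k : ℤ)) 2,
      ← zpow_mul, (Even.mul_left (by decide) _).neg_one_zpow, one_mul]
  rcases abs_choice (α - k * Real.pi) with h | h
  · rw [h, h1]
  · rw [h, mul_neg, Real.sin_neg, neg_sq, h1]

theorem abs_sin_natCast_mul_le (j : ℕ) (α : ℝ) : |Real.sin (j * α)| ≤ j * |Real.sin α| := by
  induction j with
  | zero => simp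
  | succ j ih =>
    push_cast
    rw [add_mul, one_mul, Real.sin_add]
    refine (abs_add_le _ _).trans ?_
    rw [abs_mul, abs_mul]
    have h1 := mul_le_mul_of_nonneg_left (Real.abs_cos_le_one α) (abs_nonneg (Real.sin (j * α)))
    have h2 := mul_le_mul_of_nonneg_right (Real.abs_cos_le_one (j * α)) (abs_nonneg (Real.sin α))
    linarith

/-- Just beyond the first zero `π / (2 x + 1)` of `sin ((2 x + 1) α)`, one has roughly
`sin α ≥ π / (2 x + 1)`, and `π ^ 2 / 4 > 2` leaves enough room. -/
theorem two_lt_mul_sin_sq {x : ℕ} (hx : 3 ≤ x) {α : ℝ} (h0 : Real.pi / (2 * x + 1) < α)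
    (h1 : α ≤ Real.pi / 2) : 2 < x * (x + 1) * Real.sin α ^ 2 := by
  have hx' : (3 : ℝ) ≤ x := by exact_mod_cast hx
  have hpi := Real.pi_gt_d2
  have hpi' := Real.pi_lt_d2
  set y := Real.pi / (2 * x + 1) with hy
  have hy0 : 0 < y := by positivity
  have hNy : (2 * x + 1) * y = Real.pi := by rw [hy]; field_simp
  have hy1 : y ≤ 0.45 := by
    rw [hy, div_le_iff₀ (by positivity)]; nlinarith
  have hs : Real.sin y < Real.sin α :=
    Real.sin_lt_sin_of_lt_of_le_pi_div_two (by linarith) h1 h0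
  have hc := Real.sin_gt_sub_cube hy0
  have hy2 : y ^ 2 ≤ 0.2025 := by nlinarith
  have hy3 : y ^ 3 ≤ 0.2025 * y := by rw [pow_succ]; gcongr
  have h2 : y * 0.949 < Real.sin α := by linarith
  have h3 : 2.979 < (2 * x + 1) * Real.sin α := by
    calc (2.979 : ℝ) < Real.pi * 0.949 := by nlinarith
      _ = (2 * x + 1) * (y * 0.949) := by rw [← hNy]; ring
      _ < _ := by gcongr
  have h4 : 8.87 < (2 * x + 1) ^ 2 * Real.sin α ^ 2 := by rw [← mul_pow]; nlinarith
  have h5 : Real.sin α ^ 2 ≤ ((2 * x + 1) ^ 2 * Real.sin α ^ 2) / 49 := by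
    rw [le_div_iff₀ (by norm_num), mul_comm]
    gcongr
    nlinarith
  nlinarith

/-- Since `sin ((x + 1) α) ^ 2 - sin (x α) ^ 2 = sin β sin α` with `β = (2 x + 1) α`, the claim is
`sin (x α) ^ 2 < x (x + 1) sin α ^ 2 + x sin β sin α`. If `sin β ≥ 0` it follows from
`|sin (x α)| ≤ x |sin α|`; otherwise `α > π / (2 x + 1)`, and the Cauchy–Schwarz inequality suffices
once `x (x + 1) sin α ^ 2 > 2`. The latter fails to follow from the estimates for `x = 2`, where the
claim is a polynomial inequality in `sin α`. -/
theorem sin_sq_inequality {x : ℕ} (hx : 2 ≤ x) {α : ℝ} (hα : Real.sin α ≠ 0) :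
    (x + 1) * Real.sin (x * α) ^ 2
      < x * (x + 1) * Real.sin α ^ 2 + x * Real.sin ((x + 1) * α) ^ 2 := by
  wlog h : 0 < α ∧ α ≤ Real.pi / 2 generalizing α
  · -- all three terms are even and `π`-periodic in `α`
    set k := round (α / Real.pi)
    have hpos := Real.pi_pos
    have e1 := sin_sq_natCast_mul_reduce 1 k α
    have e2 := sin_sq_natCast_mul_reduce x k α
    have e3 := sin_sq_natCast_mul_reduce (x + 1) k α
    push_cast at e1 e3
    rw [one_mul, one_mul] at e1
    rw [← e1, ← e2, ← e3]
    have hne : Real.sin |α - k * Real.pi| ≠ 0 := by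
      intro h0
      rw [h0] at e1
      exact pow_ne_zero 2 hα (by linarith)
    refine this hne ⟨?_, ?_⟩
    · refine lt_of_le_of_ne (abs_nonneg _) fun h0 => hne ?_
      rw [← h0, Real.sin_zero]
    · have h1 := abs_sub_round (α / Real.pi)
      have h2 : α - k * Real.pi = (α / Real.pi - k) * Real.pi := by field_simp
      rw [h2, abs_mul, abs_of_pos hpos]
      have : |α / Real.pi - k| * Real.pi ≤ 1 / 2 * Real.pi := by gcongr
      linarith
  obtain ⟨h0, h1⟩ := h
  have hx' : (2 : ℝ) ≤ x := by exact_mod_cast hx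
  have hs : 0 < Real.sin α := Real.sin_pos_of_pos_of_lt_pi h0 (by linarith [Real.pi_pos])
  rcases Nat.lt_or_ge x 3 with h3 | h3
  · obtain rfl : x = 2 := by omega
    have e2 := Real.sin_two_mul α
    have e3 := Real.sin_three_mul α
    have hc := Real.sin_sq_add_cos_sq α
    push_cast
    rw [show ((2 : ℝ) + 1) * α = 3 * α by norm_num, e2, e3]
    have key : 2 * (2 + 1) * Real.sin α ^ 2 + 2 * (3 * Real.sin α - 4 * Real.sin α ^ 3) ^ 2
        - (2 + 1) * (2 * Real.sin α * Real.cos α) ^ 2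
        = Real.sin α ^ 2 * (32 * (Real.sin α ^ 2 - 9 / 16) ^ 2 + 15 / 8) := by
      linear_combination (-12 * Real.sin α ^ 2) * hc
    have : 0 < Real.sin α ^ 2 * (32 * (Real.sin α ^ 2 - 9 / 16) ^ 2 + 15 / 8) := by positivity
    linarith
  · set β := (2 * x + 1) * α with hβ
    have hdiff : Real.sin ((x + 1) * α) ^ 2 - Real.sin (x * α) ^ 2 = Real.sin β * Real.sin α := by
      have e1 : β = x * α + (x + 1) * α := by rw [hβ]; ring
      have e2 : Real.sin α = Real.sin ((x + 1) * α - x * α) := by congr 1; ring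
      rw [e2, e1, Real.sin_add, Real.sin_sub]
      linear_combination Real.sin (x * α) ^ 2 * Real.sin_sq_add_cos_sq ((x + 1) * α)
        - Real.sin ((x + 1) * α) ^ 2 * Real.sin_sq_add_cos_sq (x * α)
    suffices hsuff : 0 < x * (x + 1) * Real.sin α ^ 2 + x * (Real.sin β * Real.sin α)
        - Real.sin (x * α) ^ 2 by
      rw [← hdiff] at hsuff; linarith
    rcases le_or_gt 0 (Real.sin β) with hb | hb
    · have h4 := abs_sin_natCast_mul_le x α
      rw [abs_of_pos hs] at h4
      have h5 : Real.sin (x * α) ^ 2 ≤ (x * Real.sin α) ^ 2 := by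
        rw [← sq_abs]; exact pow_le_pow_left₀ (abs_nonneg _) h4 2
      have h6 : 0 ≤ x * (Real.sin β * Real.sin α) := by positivity
      have h7 : 0 < x * Real.sin α ^ 2 := by positivity
      nlinarith
    · have hβπ : Real.pi < β := by
        by_contra hc
        push Not at hc
        have : 0 ≤ β := by positivity
        linarith [Real.sin_nonneg_of_nonneg_of_le_pi this hc]
      have hw := two_lt_mul_sin_sq h3 (α := α) (by
        rw [div_lt_iff₀ (by positivity), mul_comm]; exact hβπ) h1
      have hS : 2 * Real.sin (x * α) ^ 2
          = 1 - (Real.cos β * Real.cos α + Real.sin β * Real.sin α) := by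
        rw [← Real.cos_sub, show β - α = 2 * (x * α) by rw [hβ]; ring, Real.cos_two_mul]
        linear_combination 2 * Real.sin_sq_add_cos_sq (x * α)
      -- Cauchy–Schwarz for the vectors `((2x+1) sin α, cos α)` and `(sin β, cos β)`
      have hcs : ((2 * x + 1) * Real.sin α * Real.sin β + Real.cos α * Real.cos β) ^ 2
          ≤ 1 + 4 * (x * (x + 1) * Real.sin α ^ 2) := by
        have e1 := Real.sin_sq_add_cos_sq α
        have e2 := Real.sin_sq_add_cos_sq β
        have e3 : 1 + 4 * (x * (x + 1) * Real.sin α ^ 2)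
            = (((2 * x + 1) * Real.sin α) ^ 2 + Real.cos α ^ 2)
              * (Real.sin β ^ 2 + Real.cos β ^ 2) := by
          rw [e2, mul_one]; linear_combination -e1
        rw [e3]
        nlinarith [sq_nonneg ((2 * x + 1) * Real.sin α * Real.cos β - Real.cos α * Real.sin β)]
      generalize x * (x + 1) * Real.sin α ^ 2 = w at hw hcs ⊢
      have hlt : |(2 * x + 1) * Real.sin α * Real.sin β + Real.cos α * Real.cos β| < 2 * w - 1 := by
        refine abs_lt_of_sq_lt_sq (hcs.trans_lt ?_) (by linarith)
        nlinarith
      have := (abs_lt.1 hlt).1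
      nlinarith

/-- The trigonometric inequality is the statement that this norm is at least `2`. -/
theorem norm_sq_eq_of_sin (x α : ℝ) :
    ‖((x : ℂ) + 1) + phase (x * (2 * α)) - x * phase (-(2 * α))‖ ^ 2
      = 4 + 4 * (x * (x + 1) * Real.sin α ^ 2 + x * Real.sin ((x + 1) * α) ^ 2
        - (x + 1) * Real.sin (x * α) ^ 2) := by
  rw [← normSq_eq_norm_sq, normSq_apply]
  simp only [add_re, sub_re, add_im, sub_im, re_ofReal_mul, im_ofReal_mul, phase_re, phase_im,
    one_re, one_im, ofReal_re, ofReal_im]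
  rw [Real.cos_neg, Real.sin_neg, show x * (2 * α) = 2 * (x * α) by ring, Real.cos_two_mul,
    Real.cos_two_mul, Real.sin_two_mul, Real.sin_two_mul, add_mul, one_mul, Real.sin_add]
  have e1 := Real.sin_sq_add_cos_sq α
  have e2 := Real.sin_sq_add_cos_sq (x * α)
  have f1 : Real.cos α ^ 2 = 1 - Real.sin α ^ 2 := by linarith
  have f2 : Real.cos (x * α) ^ 2 = 1 - Real.sin (x * α) ^ 2 := by linarith
  generalize Real.sin (x * α) = S at *
  generalize Real.cos (x * α) = C at *
  generalize Real.sin α = s at *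
  generalize Real.cos α = c at *
  rw [f1, f2]
  ring_nf
  simp only [f1, f2]
  ring

end Trigonometry

/-! ### Walks at special vertices -/

section

theorem abs_le_norm_phaseMix {p : ℝ} (hp0 : 0 ≤ p) (hp1 : p ≤ 1) (x y : ℝ) :
    |2 * p - 1| ≤ ‖phaseMix p x y‖ := by
  have h1 : ‖(p : ℂ) * phase x‖ = p := by
    rw [norm_mul, norm_phase, mul_one, norm_real, Real.norm_of_nonneg hp0]
  have h2 : ‖(1 - p : ℂ) * phase y‖ = 1 - p := by
    rw [norm_mul, norm_phase, mul_one, ← ofReal_one, ← ofReal_sub, norm_real,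
      Real.norm_of_nonneg (by linarith)]
  have := abs_norm_sub_norm_le ((p : ℂ) * phase x) (-((1 - p : ℂ) * phase y))
  rw [norm_neg, h1, h2, sub_neg_eq_add] at this
  refine le_trans (le_of_eq ?_) this
  congr 1; ring

theorem norm_phaseMix_of_phase_sub {p x y : ℝ} (h : phase (x - y) = -1) :
    ‖phaseMix p x y‖ = |2 * p - 1| := by
  have hx : phase x = -phase y := by
    calc phase x = phase (x - y) * phase y := by rw [← phase_add, sub_add_cancel]
      _ = _ := by rw [h]; ring
  have : phaseMix p x y = ((1 - 2 * p : ℝ) : ℂ) * phase y := by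
    rw [phaseMix, hx]; push_cast; ring
  rw [this, norm_mul, norm_phase, mul_one, norm_real, Real.norm_eq_abs, abs_sub_comm]

variable {k : ℕ} {N : Fin k → ℕ}

/-- A cone vertex (a part of size one) over a regular graph: the walk at this vertex only involves
two phases, whose rates differ by `√D`. -/
theorem cone_vertex_walk (hN : ∀ ℓ, 1 ≤ N ℓ) (hk : 2 ≤ k) {n : ℕ} (hn : n = ∑ ℓ, N ℓ)
    {I : Finset (Fin k)} (hI1 : ∀ ℓ ∈ I, N ℓ = 1) {m : ℕ} (hI : I.card = 1)
    (hm : ∀ r ∉ I, N r = m) {u : Σ ℓ : Fin k, Fin (N ℓ)} (hu : u.1 ∈ I) {d D : ℝ}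
    (hd : d = (n : ℝ) - m - 1) (hD : D = d ^ 2 + 4 * ((n : ℝ) - 1)) :
    0 < D ∧ (∀ t, √(d ^ 2 / D) ≤ ‖transition (multipartite N) t u u‖) ∧
      ∀ j : ℤ, Odd j → ‖transition (multipartite N) (j * Real.pi / √D) u u‖ = √(d ^ 2 / D) := by
  have hIne : I.Nonempty := ⟨_, hu⟩
  have hI' : I ≠ Finset.univ := by
    intro h
    rw [h, Finset.card_univ, Fintype.card_fin] at hI
    omega
  set T := partsUnion N I with hTdef
  have hT : IsTwinSet (multipartite N) T 1 := isTwinSet_singletons hIne hI1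
  have hTc : T.card = 1 := by rw [card_partsUnion, card_partsUnion_singletons hI1, hI]
  have hcc : ((Tᶜ).card : ℝ) = n - 1 := by
    rw [card_compl_partsUnion, card_partsUnion_singletons hI1, hI, ← hn]; push_cast; ring
  have hreg : IsRegularOutside (multipartite N) T d := by
    have := isRegularOutside hm
    rw [card_partsUnion_singletons hI1, hI, ← hn] at this
    rwa [hd, show (n : ℝ) - m - 1 = n - (1 : ℕ) - m by push_cast; ring]
  have hn1 : 0 < (n : ℝ) - 1 := by
    rw [← hcc]; exact_mod_cast (compl_partsUnion_nonempty hN hI').card_pos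
  have hD0 : 0 < D := by rw [hD]; positivity
  have hR : 0 < √D := Real.sqrt_pos.2 hD0
  have hR2 : √D ^ 2 = (1 * ((T.card : ℝ) - 1) - d) ^ 2 + 4 * T.card * (Tᶜ).card := by
    rw [Real.sq_sqrt hD0.le, hTc, hcc, hD]; push_cast; ring
  obtain ⟨hp0, hp1⟩ := quotient_weight_mem_Ioo hR hR2 (by rw [hTc, hcc]; push_cast; linarith)
  have huT : u ∈ T := mem_partsUnion.2 hu
  have hU := fun t => congrArg norm (hT.transition_apply hreg hR hR2 huT huT t)
  set p := (1 + (1 * ((T.card : ℝ) - 1) - d) / √D) / 2 with hp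
  have hp2 : |2 * p - 1| = √(d ^ 2 / D) := by
    rw [Real.sqrt_div (sq_nonneg d), Real.sqrt_sq_eq_abs, ← abs_of_pos hR, ← abs_div, ← abs_neg,
      hp, hTc]
    congr 1; push_cast; ring
  have hU' : ∀ t, ‖transition (multipartite N) t u u‖
      = ‖phaseMix p ((1 * ((T.card : ℝ) + 1) + d + √D) / 2 * t)
          ((1 * ((T.card : ℝ) + 1) + d - √D) / 2 * t)‖ := by
    intro t
    rw [hU t, norm_mul, norm_phase, one_mul, if_pos rfl]
    congr 1
    have : (T.card : ℂ) = 1 := by rw [hTc]; simp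
    rw [this]; ring
  refine ⟨hD0, fun t => ?_, fun j hj => ?_⟩
  · rw [hU' t, ← hp2]
    exact abs_le_norm_phaseMix hp0.le hp1.le _ _
  · rw [hU', ← hp2]
    refine norm_phaseMix_of_phase_sub ((phase_eq_neg_one_iff _).2 ⟨j, hj, ?_⟩)
    field_simp; ring

/-- The walk on a part of size two when the relative rates are `g (d + 1)` and `-g`, with `d` odd:
its return probability has a unique minimum in each period. -/
theorem norm_half_add_phaseMix {d : ℤ} (hd : Odd d) (hd0 : 0 < d) (θ : ℝ) :
    1 / ((d : ℝ) + 2) ≤ ‖(1 : ℂ) / 2 + 1 / 2 * phaseMix (1 / ((d : ℝ) + 2)) ((d + 1) * θ) (-θ)‖ ∧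
    (‖(1 : ℂ) / 2 + 1 / 2 * phaseMix (1 / ((d : ℝ) + 2)) ((d + 1) * θ) (-θ)‖ = 1 / ((d : ℝ) + 2) ↔
      ∃ j : ℤ, Odd j ∧ θ = j * Real.pi) := by
  obtain ⟨x, hx⟩ : ∃ x : ℕ, (x : ℤ) = d + 1 := ⟨(d + 1).toNat, Int.toNat_of_nonneg (by omega)⟩
  have hxr : (x : ℝ) = d + 1 := by exact_mod_cast hx
  have hd' : (d : ℝ) = x - 1 := by linarith
  have hx2 : 2 ≤ x := by omega
  obtain ⟨i, hi⟩ : Even (x : ℤ) := by rw [hx]; exact hd.add_one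
  -- `x = d + 1` is even; `α` measures the deviation of `θ` from the minimum at `π`
  set α := (θ - Real.pi) / 2 with hα
  have hθ : θ = 2 * α + Real.pi := by rw [hα]; ring
  have hx0 : (0 : ℝ) < x := by positivity
  set z : ℂ := (1 : ℂ) / 2 + 1 / 2 * phaseMix (1 / ((d : ℝ) + 2)) ((d + 1) * θ) (-θ) with hz
  have hz' : ((2 * (x + 1) : ℝ) : ℂ) * z
      = (((x : ℝ) : ℂ) + 1) + phase (x * (2 * α)) - (x : ℝ) * phase (-(2 * α)) := by
    have h1 : phase ((d + 1) * θ) = phase (x * (2 * α)) := by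
      rw [← hxr, hθ, ← phase_add_int_mul_two_pi (x * (2 * α)) i]
      congr 1
      have : (x : ℝ) = i + i := by exact_mod_cast hi
      rw [mul_add]
      linear_combination Real.pi * this
    have h2 : phase (-θ) = -phase (-(2 * α)) := by
      have : phase (-Real.pi) = -1 := (phase_eq_neg_one_iff _).2 ⟨-1, odd_neg_one, by push_cast; ring⟩
      rw [hθ, neg_add, phase_add, this]; ring
    have hxc : ((x : ℝ) : ℂ) + 1 ≠ 0 := by
      have : (x : ℝ) + 1 ≠ 0 := by positivity
      exact_mod_cast this
    rw [hz, phaseMix, h1, h2, hd', show (x : ℝ) - 1 + 2 = x + 1 by ring]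
    push_cast at hxc ⊢
    field_simp
    ring
  have hnorm : (2 * ((x : ℝ) + 1)) ^ 2 * ‖z‖ ^ 2
      = 4 + 4 * (x * (x + 1) * Real.sin α ^ 2 + x * Real.sin ((x + 1) * α) ^ 2
        - (x + 1) * Real.sin (x * α) ^ 2) := by
    rw [← norm_sq_eq_of_sin, ← hz', norm_mul, norm_real, Real.norm_of_nonneg (by positivity),
      mul_pow (2 * ((x : ℝ) + 1))]
  have hd2 : 1 / ((d : ℝ) + 2) = 1 / (x + 1) := by rw [hd']; congr 1; ring
  have hsin : Real.sin α = 0 ↔ ∃ j : ℤ, Odd j ∧ θ = j * Real.pi := by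
    rw [Real.sin_eq_zero_iff]
    constructor
    · rintro ⟨l, hl⟩
      exact ⟨2 * l + 1, odd_two_mul_add_one l, by rw [hθ, ← hl]; push_cast; ring⟩
    · rintro ⟨j, ⟨l, rfl⟩, hj⟩
      exact ⟨l, by rw [hα, hj]; push_cast; ring⟩
  rw [hd2, ← hsin]
  have hsq : ‖z‖ ^ 2 = (1 / ((x : ℝ) + 1)) ^ 2 + (x * (x + 1) * Real.sin α ^ 2
      + x * Real.sin ((x + 1) * α) ^ 2 - (x + 1) * Real.sin (x * α) ^ 2) / (x + 1) ^ 2 := by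
    field_simp
    linear_combination hnorm / 4
  have hpos : 0 < 1 / ((x : ℝ) + 1) := by positivity
  by_cases h0 : Real.sin α = 0
  · have h1 : Real.sin (x * α) = 0 := by
      have := abs_sin_natCast_mul_le x α
      rw [h0, abs_zero, mul_zero] at this
      exact abs_eq_zero.1 (le_antisymm this (abs_nonneg _))
    have h2 : Real.sin ((x + 1) * α) = 0 := by
      rw [add_mul, one_mul, Real.sin_add, h1, h0]; ring
    rw [h0, h1, h2] at hsq
    have heq : ‖z‖ = 1 / ((x : ℝ) + 1) := by
      refine (pow_left_inj₀ (norm_nonneg _) hpos.le two_ne_zero).1 ?_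
      rw [hsq]; ring
    exact ⟨heq.ge, fun _ => h0, fun _ => heq⟩
  · have hlt : 1 / ((x : ℝ) + 1) < ‖z‖ := by
      refine lt_of_pow_lt_pow_left₀ 2 (norm_nonneg _) ?_
      rw [hsq, lt_add_iff_pos_right]
      have := sin_sq_inequality hx2 h0
      exact div_pos (by linarith) (by positivity)
    exact ⟨hlt.le, fun h => absurd h hlt.ne', fun h => absurd h h0⟩

theorem mulVec_multipartite (x : (Σ ℓ : Fin k, Fin (N ℓ)) → ℝ) (v : Σ ℓ : Fin k, Fin (N ℓ)) :
    ((multipartite N).adjMatrix ℝ).mulVec x v = ∑ w, x w - ∑ w ∈ partsUnion N {v.1}, x w := by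
  have h1 : ∑ w ∈ partsUnion N {v.1}, x w = ∑ w, if v.1 = w.1 then x w else 0 := by
    rw [partsUnion, Finset.sum_filter]
    refine Finset.sum_congr rfl fun w _ => ?_
    simp only [Finset.mem_singleton, eq_comm]
  rw [h1, ← Finset.sum_sub_distrib, Matrix.mulVec, dotProduct]
  refine Finset.sum_congr rfl fun w _ => ?_
  rw [multipartite_adjMatrix]
  split_ifs <;> ring

/-- A vector in the kernel of the adjacency matrix sums to zero over each part. -/
theorem sum_part_eq_zero_of_mulVec (hN : ∀ ℓ, 1 ≤ N ℓ) (hk : 2 ≤ k)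
    {x : (Σ ℓ : Fin k, Fin (N ℓ)) → ℝ}
    (hx : ((multipartite N).adjMatrix ℝ).mulVec x = (0 : ℝ) • x) (ℓ : Fin k) :
    ∑ w ∈ partsUnion N {ℓ}, x w = 0 := by
  have hpart : ∀ r, ∑ w ∈ partsUnion N {r}, x w = ∑ w, x w := by
    intro r
    have h := congrFun hx ⟨r, ⟨0, hN r⟩⟩
    rw [mulVec_multipartite, zero_smul, Pi.zero_apply] at h
    linarith
  have htot : ∑ w, x w = ∑ r, ∑ w ∈ partsUnion N {r}, x w := by
    rw [← Finset.sum_fiberwise Finset.univ (fun w : Σ ℓ : Fin k, Fin (N ℓ) => w.1) x]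
    refine Finset.sum_congr rfl fun r _ => Finset.sum_congr ?_ fun _ _ => rfl
    ext w; simp [partsUnion]
  simp_rw [hpart] at htot
  rw [Finset.sum_const, Finset.card_univ, Fintype.card_fin, nsmul_eq_mul] at htot
  have hk' : (2 : ℝ) ≤ k := by exact_mod_cast hk
  rw [hpart ℓ]
  have : ((k : ℝ) - 1) * ∑ w, x w = 0 := by linarith
  exact (mul_eq_zero.1 this).resolve_left (by linarith)

/-- An eigenvector which does not vanish at `u` puts its eigenvalue into the support of `u`. -/
theorem mem_eigenvalueSupport {V : Type*} [Fintype V] [DecidableEq V] {G : SimpleGraph V}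
    [DecidableRel G.Adj] {lam : ℝ} {x : EuclideanSpace ℝ V}
    (hx : (G.adjMatrix ℝ).mulVec x = lam • (x : V → ℝ)) {u : V} (hu : x u ≠ 0) :
    lam ∈ eigenvalueSupport G u := by
  intro h
  rw [Submodule.starProjection_apply_eq_zero_iff] at h
  have hmem : x ∈ Module.End.eigenspace (Matrix.toEuclideanLin (G.adjMatrix ℝ)) lam := by
    rw [Module.End.mem_eigenspace_iff]
    ext v
    exact congrFun hx v
  have := h x hmem
  rw [EuclideanSpace.inner_single_right] at this
  simp [hu] at this

/-- Since the kernel of the adjacency matrix is orthogonal to the indicator vector of the part of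
`u`, the eigenvalue `0` has weight exactly `1 - 1 / N u.1` at `u`; all other phases are brought
close to `-1` by Kronecker's theorem. -/
theorem isSharplySedentary_of_linearIndepOn (hN : ∀ ℓ, 1 ≤ N ℓ) (hk : 2 ≤ k)
    {u : Σ ℓ : Fin k, Fin (N ℓ)} (hu : 3 ≤ N u.1)
    (hind : LinearIndepOn ℚ (fun x : ℝ => x) (eigenvalueSupport (multipartite N) u \ {0})) :
    IsSharplySedentary (multipartite N) u (1 - 2 / (N u.1 : ℝ)) := by
  set T := partsUnion N {u.1} with hTdef
  have hT : IsTwinSet (multipartite N) T 0 := isTwinSet_part hN u.1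
  have huT : u ∈ T := by simp [hTdef, mem_partsUnion]
  have hTc : T.card = N u.1 := by rw [card_partsUnion, Finset.sum_singleton]
  have hu' : (3 : ℝ) ≤ N u.1 := by exact_mod_cast hu
  have hlow := hT.le_norm_transition huT
  rw [hTc] at hlow
  refine isSharplySedentary_of_forall_le ?_ hlow fun ε hε => ?_
  · rw [sub_pos, div_lt_one (by linarith)]; linarith
  obtain ⟨lam, b, hb⟩ := exists_orthonormal_eigenvectors (multipartite N)
  have hw1 := hT.le_sum_weight huT hb
  have hw2 := sum_weight_le_of_sum_eq_zero (θ := 0) huT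
    (fun x hx => sum_part_eq_zero_of_mulVec hN hk hx u.1) hb
  have hs := sum_basis_apply_sq b u
  rw [← Finset.sum_filter_add_sum_filter_not _ (fun j => lam j = 0)] at hs
  rw [neg_zero] at hw1
  rw [hTc] at hw1 hw2
  have hW := le_antisymm hw2 hw1
  -- the nonzero eigenvalues with positive weight at `u`
  let F : Set ℝ := {μ | ∃ j, lam j = μ ∧ lam j ≠ 0 ∧ b j u ≠ 0}
  have hF : F ⊆ eigenvalueSupport (multipartite N) u \ {0} := by
    rintro _ ⟨j, rfl, h0, hj⟩
    exact ⟨mem_eigenvalueSupport (hb j) hj, h0⟩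
  have hFfin : F.Finite := (Set.finite_range lam).subset (by
    rintro _ ⟨j, rfl, -, -⟩; exact ⟨j, rfl⟩)
  have : Fintype F := hFfin.fintype
  obtain ⟨t, ht, hnear⟩ := exists_forall_phase_near_neg_one (fun x : F => (x : ℝ))
    (hind.mono hF) 0 hε
  refine ⟨t, ht, ?_⟩
  rw [transition_apply_spectral _ hb, ← Finset.sum_filter_add_sum_filter_not _ (fun j => lam j = 0)]
  have h1 : ∑ j with lam j = 0, phase (lam j * t) * ((b j u ^ 2 : ℝ) : ℂ)
      = ((1 - 1 / (N u.1 : ℝ) : ℝ) : ℂ) := by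
    rw [← hW, ofReal_sum]
    refine Finset.sum_congr rfl fun j hj => ?_
    rw [(Finset.mem_filter.1 hj).2, zero_mul, phase_zero, one_mul]
  have hrest : ∑ j with ¬ lam j = 0, b j u ^ 2 = 1 / (N u.1 : ℝ) := by linarith
  have h2 : ∑ j with ¬ lam j = 0, phase (lam j * t) * ((b j u ^ 2 : ℝ) : ℂ)
      = (∑ j with ¬ lam j = 0, (phase (lam j * t) + 1) * ((b j u ^ 2 : ℝ) : ℂ))
        - ((1 / (N u.1 : ℝ) : ℝ) : ℂ) := by
    rw [← hrest, ofReal_sum, ← Finset.sum_sub_distrib]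
    exact Finset.sum_congr rfl fun j _ => by ring
  have h3 : ‖∑ j with ¬ lam j = 0, (phase (lam j * t) + 1) * ((b j u ^ 2 : ℝ) : ℂ)‖
      ≤ 1 / (N u.1 : ℝ) * ε := by
    rw [← hrest, Finset.sum_mul]
    refine (norm_sum_le _ _).trans (Finset.sum_le_sum fun j hj => ?_)
    rw [norm_mul, norm_real, Real.norm_of_nonneg (sq_nonneg _), mul_comm]
    by_cases hju : b j u = 0
    · simp [hju]
    · have := hnear ⟨lam j, j, rfl, (Finset.mem_filter.1 hj).2, hju⟩
      exact mul_le_mul_of_nonneg_left this.le (sq_nonneg _)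
  rw [h1, h2]
  set E := ∑ j with ¬ lam j = 0, (phase (lam j * t) + 1) * ((b j u ^ 2 : ℝ) : ℂ)
  have h4 : ((1 - 1 / (N u.1 : ℝ) : ℝ) : ℂ) + (E - ((1 / (N u.1 : ℝ) : ℝ) : ℂ))
      = ((1 - 2 / (N u.1 : ℝ) : ℝ) : ℂ) + E := by push_cast; ring
  have h5 : 0 ≤ 1 - 2 / (N u.1 : ℝ) := by
    rw [sub_nonneg, div_le_one (by linarith)]; linarith
  have h6 : 1 / (N u.1 : ℝ) ≤ 1 := by rw [div_le_one (by linarith)]; linarith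
  rw [h4]
  refine (norm_add_le _ _).trans ?_
  rw [norm_real, Real.norm_of_nonneg h5]
  nlinarith

end

/-! ### Sedentariness and state transfer -/

variable {k : ℕ} {N : Fin k → ℕ}

theorem odd_of_nu2_mul_le {g d : ℤ} (hg : g ≠ 0) (h : nu2 (g * d) ≤ nu2 g) : Odd d := by
  rw [nu2_mul] at h
  have h1 : nu2 g + nu2 d ≤ nu2 g + 0 := by rwa [add_zero]
  have h2 : nu2 d ≤ 0 := (WithTop.add_le_add_iff_left (nu2_ne_top hg)).1 h1
  have h3 : nu2 d = 0 := le_antisymm h2 bot_le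
  rw [← Int.not_even_iff_odd, even_iff_two_dvd]
  exact emultiplicity_eq_zero.1 h3

/-- The walk on a part of size two, after factoring `n - m - 2 = g d` and `Δ = (g (d + 2)) ^ 2`. -/
theorem norm_transition_pair_eq (hN : ∀ ℓ, 1 ≤ N ℓ) {n : ℕ} (hn : n = ∑ ℓ, N ℓ)
    {u : Σ ℓ : Fin k, Fin (N ℓ)} (hu : N u.1 = 2) {m : ℕ} (hm : ∀ r, r ≠ u.1 → N r = m)
    {g : ℕ} {d : ℤ} (hg : 0 < g) (hd : 0 < d) (hb : (n : ℤ) - m - 2 = g * d)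
    (hs : 2 * ((n : ℤ) - 2) = g * ((n : ℤ) - m - 2 + g)) (t : ℝ) :
    ‖transition (multipartite N) t u u‖
      = ‖(1 : ℂ) / 2 + 1 / 2 * phaseMix (1 / ((d : ℝ) + 2)) ((d + 1) * (g * t)) (-(g * t))‖ := by
  set T := partsUnion N {u.1} with hTdef
  have hT : IsTwinSet (multipartite N) T 0 := isTwinSet_part hN u.1
  have huT : u ∈ T := by simp [hTdef, mem_partsUnion]
  have hTc : T.card = 2 := by rw [card_partsUnion, Finset.sum_singleton, hu]
  have hcc : ((Tᶜ).card : ℝ) = n - 2 := by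
    rw [card_compl_partsUnion, Finset.sum_singleton, hu, ← hn]; push_cast; ring
  have hbr : (n : ℝ) - m - 2 = g * d := by exact_mod_cast hb
  have hsr : 2 * ((n : ℝ) - 2) = g * ((n : ℝ) - m - 2 + g) := by exact_mod_cast hs
  have hreg : IsRegularOutside (multipartite N) T ((g : ℝ) * d) := by
    have := isRegularOutside (N := N) (I := {u.1}) (m := m) fun r hr => hm r (by simpa using hr)
    rw [Finset.sum_singleton, hu, ← hn] at this
    rw [← hbr]
    rwa [show (n : ℝ) - m - 2 = n - (2 : ℕ) - m by push_cast; ring]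
  have hg' : (0 : ℝ) < g := by exact_mod_cast hg
  have hd' : (0 : ℝ) < d := by exact_mod_cast hd
  have hU := hT.transition_apply hreg (R := g * (d + 2)) (by positivity) (by
    rw [hTc, hcc]
    push_cast
    rw [hbr] at hsr
    linear_combination -4 * hsr) huT huT t
  rw [hU, norm_mul, norm_phase, one_mul, if_pos rfl, hTc]
  have e1 : (1 + (0 * (((2 : ℕ) : ℝ) - 1) - (g : ℝ) * d) / (g * (d + 2))) / 2 = 1 / ((d : ℝ) + 2) := by
    field_simp; ring
  have e2 : (0 * (((2 : ℕ) : ℝ) + 1) + (g : ℝ) * d + g * (d + 2)) / 2 * t = (d + 1) * (g * t) := by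
    ring
  have e3 : (0 * (((2 : ℕ) : ℝ) + 1) + (g : ℝ) * d - g * (d + 2)) / 2 * t = -(g * t) := by ring
  rw [e1, e2, e3]
  congr 1
  push_cast; ring

theorem card_eq_of_equal_parts {n : ℕ} (hn : n = ∑ ℓ, N ℓ) {ℓ : Fin k} {m : ℕ}
    (hm : ∀ r, r ≠ ℓ → N r = m) : (n : ℤ) = N ℓ + ((k : ℤ) - 1) * m := by
  have hk : 1 ≤ k := Fin.pos ℓ
  rw [hn, ← Finset.add_sum_erase _ _ (Finset.mem_univ ℓ),
    Finset.sum_congr rfl fun r hr => hm r (Finset.ne_of_mem_erase hr), Finset.sum_const,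
    Finset.card_erase_of_mem (Finset.mem_univ ℓ), Finset.card_univ, Fintype.card_fin, smul_eq_mul]
  push_cast [Nat.cast_sub hk]
  ring

/-- Counting vertices leaves only `s = 2` (with `m = 2`) and `s = 3` (with `m = 9`) as positive
solutions `s ≠ 1`; in both cases `s` divides `n - m - 2`. -/
theorem dvd_of_root {c m s : ℤ} (hc : 1 ≤ c) (hm : 1 ≤ m) (hs : 2 ≤ s)
    (h : 2 * ((c + 1) * m) = s * (c * m + s)) : s ∣ c * m := by
  have hcm : m ≤ c * m := by nlinarith
  have hs4 : s < 4 := by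
    by_contra h4
    push Not at h4
    nlinarith [mul_le_mul h4 (by linarith : c * m + 4 ≤ c * m + s) (by linarith) (by linarith)]
  obtain rfl | rfl : s = 2 ∨ s = 3 := by omega
  · have : m = 2 := by linarith
    rw [this]; exact Dvd.intro_left c rfl
  · have h9 : 2 * m = c * m + 9 := by linarith
    have hc1 : c = 1 := by
      by_contra hne
      have : 2 ≤ c := by omega
      nlinarith
    subst hc1
    exact ⟨3, by linarith⟩

end QuantumWalk

open QuantumWalk

theorem theorem5p7 {k : ℕ} (hk : 2 ≤ k) (N : Fin k → ℕ) (hN : ∀ ℓ, 1 ≤ N ℓ)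
    (n : ℕ) (hn : n = ∑ ℓ, N ℓ) :
    -- (1) parts of size one, indexed by the nonempty set `I`
    (∀ I : Finset (Fin k), I.Nonempty → (∀ ℓ ∈ I, N ℓ = 1) →
      -- (1a) one part of size one, the other parts of equal size
      (∀ m : ℕ, I.card = 1 → (∀ r ∉ I, N r = m) →
        ∀ u : (Σ ℓ : Fin k, Fin (N ℓ)), u.1 ∈ I →
        ∀ d D : ℝ, d = (n : ℝ) - m - 1 → D = d ^ 2 + 4 * ((n : ℝ) - 1) →
          (∀ t : ℝ, √(d ^ 2 / D) ≤ ‖QuantumWalk.transition (QuantumWalk.multipartite N) t u u‖) ∧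
          (∀ j : ℤ, Odd j →
            ‖QuantumWalk.transition (QuantumWalk.multipartite N) (j * Real.pi / √D) u u‖
              = √(d ^ 2 / D)) ∧
          (m + 1 < n →
            QuantumWalk.IsCSedentary (QuantumWalk.multipartite N) u (d ^ 2 / D) ∧
            ∀ j : ℤ, Odd j → 0 < j →
              QuantumWalk.IsTightlySedentaryAt (QuantumWalk.multipartite N) u (√(d ^ 2 / D))
                (j * Real.pi / √D))) ∧
      -- (1b) two parts of size one, the other parts (at least one) of equal size
      (∀ m : ℕ, I.card = 2 → I ≠ Finset.univ → (∀ r ∉ I, N r = m) →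
        ∀ Δ : ℤ, Δ = ((n : ℤ) - m - 3) ^ 2 + 8 * ((n : ℤ) - 2) →
          (¬ IsSquare Δ → ∀ u v : (Σ ℓ : Fin k, Fin (N ℓ)), u.1 ∈ I → v.1 ∈ I → u ≠ v →
            QuantumWalk.HasPGST (QuantumWalk.multipartite N) u v) ∧
          (∀ q : ℕ, Δ = (q : ℤ) ^ 2 →
            QuantumWalk.nu2 ((n : ℤ) - m + 1) ≠ QuantumWalk.nu2 q →
            ∀ u v : (Σ ℓ : Fin k, Fin (N ℓ)), u.1 ∈ I → v.1 ∈ I → u ≠ v →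
              QuantumWalk.HasPST (QuantumWalk.multipartite N) u v) ∧
          (∀ q : ℕ, Δ = (q : ℤ) ^ 2 →
            QuantumWalk.nu2 ((n : ℤ) - m + 1) = QuantumWalk.nu2 q →
            ∀ u : (Σ ℓ : Fin k, Fin (N ℓ)), u.1 ∈ I →
              ∃ C : ℝ, QuantumWalk.IsTightlySedentary (QuantumWalk.multipartite N) u C)) ∧
      -- (1c) at least three parts of size one
      (3 ≤ I.card → ∀ u : (Σ ℓ : Fin k, Fin (N ℓ)), u.1 ∈ I →
        (∀ t : ℝ, 1 - 2 / (I.card : ℝ) ≤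
          ‖QuantumWalk.transition (QuantumWalk.multipartite N) t u u‖) ∧
        (∀ m : ℕ, I ≠ Finset.univ → (∀ r ∉ I, N r = m) →
          ∀ Δ : ℤ, Δ = ((n : ℤ) - m - 2 * I.card + 1) ^ 2 + 4 * I.card * ((n : ℤ) - I.card) →
            (∀ q : ℕ, Δ = (q : ℤ) ^ 2 →
              (QuantumWalk.nu2 ((n : ℤ) - m + 1) ≠ QuantumWalk.nu2 q →
                ∀ g : ℕ, g = Int.gcd ((n : ℤ) - m + 1 + q) ((n : ℤ) - m + 1 - q) →
                ∀ j : ℤ, Odd j → 0 < j →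
                  QuantumWalk.IsTightlySedentaryAt (QuantumWalk.multipartite N) u
                    (1 - 2 / (I.card : ℝ)) (2 * j * Real.pi / g)) ∧
              (QuantumWalk.nu2 ((n : ℤ) - m + 1) = QuantumWalk.nu2 q →
                ∃ C : ℝ, 1 - 2 / (I.card : ℝ) < C ∧
                  QuantumWalk.IsTightlySedentary (QuantumWalk.multipartite N) u C)) ∧
            (¬ IsSquare Δ →
              QuantumWalk.IsSharplySedentary (QuantumWalk.multipartite N) u
                (1 - 2 / (I.card : ℝ))))) ∧
      -- (1d) all remaining parts have size two, and there are at least two of them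
      (I.card + 4 ≤ n → (∀ r ∉ I, N r = 2) →
        ∀ Δ : ℤ, Δ = ((n : ℤ) - 1) ^ 2 + 4 * I.card →
          (¬ IsSquare Δ →
            ∀ u v : (Σ ℓ : Fin k, Fin (N ℓ)), N u.1 = 2 → u.1 = v.1 → u ≠ v →
              (QuantumWalk.HasPGST (QuantumWalk.multipartite N) u v ↔ n % 4 = 3)) ∧
          (∀ q : ℕ, Δ = (q : ℤ) ^ 2 →
            ∀ u v : (Σ ℓ : Fin k, Fin (N ℓ)), N u.1 = 2 → u.1 = v.1 → u ≠ v →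
              (QuantumWalk.HasPST (QuantumWalk.multipartite N) u v ↔
                QuantumWalk.nu2 ((n : ℤ) - 3) ≠ QuantumWalk.nu2 q)) ∧
          (((¬ IsSquare Δ ∧ n % 4 ≠ 3) ∨
              (∃ q : ℕ, Δ = (q : ℤ) ^ 2 ∧ QuantumWalk.nu2 ((n : ℤ) - 3) = QuantumWalk.nu2 q)) →
            ∀ u : (Σ ℓ : Fin k, Fin (N ℓ)), N u.1 = 2 →
              QuantumWalk.IsSedentary (QuantumWalk.multipartite N) u))) ∧
    -- (2) `u` lies in a part of size two, the other parts have equal size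
    (∀ u v : (Σ ℓ : Fin k, Fin (N ℓ)), N u.1 = 2 →
      QuantumWalk.IsTwin (QuantumWalk.multipartite N) u v →
      ∀ m : ℕ, (∀ r, r ≠ u.1 → N r = m) →
        (∀ Δ : ℤ, Δ = ((n : ℤ) - m - 2) ^ 2 + 8 * ((n : ℤ) - 2) →
          ((¬ IsSquare Δ ∨
              (∃ q : ℕ, Δ = (q : ℤ) ^ 2 ∧
                QuantumWalk.nu2 ((n : ℤ) - m - 2) ≠ QuantumWalk.nu2 q) ∨
              n = m + 2) →
            QuantumWalk.IsNotSedentary (QuantumWalk.multipartite N) u) ∧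
          (¬ IsSquare Δ → QuantumWalk.HasPGST (QuantumWalk.multipartite N) u v) ∧
          (((∃ q : ℕ, Δ = (q : ℤ) ^ 2 ∧
                QuantumWalk.nu2 ((n : ℤ) - m - 2) ≠ QuantumWalk.nu2 q) ∨
              n = m + 2) →
            QuantumWalk.HasPST (QuantumWalk.multipartite N) u v)) ∧
        (m + 2 < n → ∀ s : ℤ, 2 * ((n : ℤ) - 2) = s * ((n : ℤ) - m - 2 + s) →
          QuantumWalk.nu2 ((n : ℤ) - m - 2) ≤ QuantumWalk.nu2 s →
          ∀ (g : ℕ) (d₁ s₁ : ℤ), g = Int.gcd ((n : ℤ) - m - 2) s →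
            (n : ℤ) - m - 2 = g * d₁ → s = g * s₁ →
            (s₁ = 1 → ∀ t : ℝ,
              1 / ((d₁ : ℝ) + 2) ≤
                ‖QuantumWalk.transition (QuantumWalk.multipartite N) t u u‖ ∧
              (‖QuantumWalk.transition (QuantumWalk.multipartite N) t u u‖ =
                  1 / ((d₁ : ℝ) + 2) ↔
                ∃ j : ℤ, Odd j ∧ t = j * Real.pi / g)) ∧
            (2 ≤ s₁ → ∀ t : ℝ,
              √2 / ((d₁ : ℝ) + 2 * s₁) ≤
                ‖QuantumWalk.transition (QuantumWalk.multipartite N) t u u‖ ∧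
              (‖QuantumWalk.transition (QuantumWalk.multipartite N) t u u‖ =
                  √2 / ((d₁ : ℝ) + 2 * s₁) ↔
                ∃ j : ℤ, Odd j ∧ t = j * Real.pi / g)))) ∧
    -- (3) `u` lies in a part of size at least three
    (∀ u : (Σ ℓ : Fin k, Fin (N ℓ)), 3 ≤ N u.1 →
      (∀ t : ℝ, 1 - 2 / (N u.1 : ℝ) ≤
        ‖QuantumWalk.transition (QuantumWalk.multipartite N) t u u‖) ∧
      (∀ m : ℕ, (∀ r, r ≠ u.1 → N r = m) →
        ∀ Δ : ℤ, Δ = ((n : ℤ) - N u.1 - m) ^ 2 + 4 * N u.1 * ((n : ℤ) - N u.1) →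
        ∀ q : ℕ, Δ = (q : ℤ) ^ 2 →
          QuantumWalk.nu2 ((n : ℤ) - N u.1 - m) ≠ QuantumWalk.nu2 q →
          ∀ g : ℕ, g = Int.gcd ((n : ℤ) - N u.1 - m + q) ((n : ℤ) - N u.1 - m - q) →
          ∀ j : ℤ, Odd j → 0 < j →
            QuantumWalk.IsTightlySedentaryAt (QuantumWalk.multipartite N) u
              (1 - 2 / (N u.1 : ℝ)) (2 * j * Real.pi / g)) ∧
      (LinearIndepOn ℚ (fun x : ℝ => x)
          (QuantumWalk.eigenvalueSupport (QuantumWalk.multipartite N) u \ {0}) →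
        QuantumWalk.IsSharplySedentary (QuantumWalk.multipartite N) u (1 - 2 / (N u.1 : ℝ)))) := by
  classical
  refine ⟨fun I hI hI1 => ⟨?_, ?_, ?_, ?_⟩, ?_, ?_⟩
  · intro m hc hm u hu d D hd hD
    obtain ⟨hD0, hlow, hatt⟩ := cone_vertex_walk hN hk hn hI1 hc hm hu hd hD
    refine ⟨hlow, hatt, fun hmn => ?_⟩
    have hd0 : 0 < d := by
      have : ((m + 1 : ℕ) : ℝ) < n := by exact_mod_cast hmn
      push_cast at this
      rw [hd]; linarith
    have hn1 : (1 : ℝ) ≤ n := by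
      have : 1 ≤ n := by omega
      exact_mod_cast this
    have hq0 : 0 < d ^ 2 / D := by positivity
    have hq1 : d ^ 2 / D ≤ 1 := by rw [div_le_one hD0, hD]; linarith
    -- the square of the sharp bound is itself a (weaker) lower bound, as it is at most `1`
    have hqs : d ^ 2 / D ≤ √(d ^ 2 / D) := Real.le_sqrt_of_sq_le (by nlinarith)
    refine ⟨isCSedentary_of_forall_le hq0 fun t => hqs.trans (hlow t), fun j hj hj0 => ?_⟩
    have hj' : (0 : ℝ) < j := by exact_mod_cast hj0
    have hR : 0 < √D := Real.sqrt_pos.2 hD0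
    exact isTightlySedentaryAt_of_forall_le (Real.sqrt_pos.2 hq0) hlow (by positivity) (hatt j hj)
  · intro m hc hI' hm Δ hΔ
    have h := isTwoPhaseWalk_singletons hN hI hI1 hI' hm hn (Δ := Δ) (by
      rw [hΔ, hc]; push_cast; ring)
    have hT : (partsUnion N I).card = 2 := by
      rw [card_partsUnion, card_partsUnion_singletons hI1, hc]
    refine ⟨fun hsq u v hu hv huv => ?_, fun q hq hne u v hu hv huv => ?_, fun q hq heq u hu => ?_⟩
    · exact h.hasPGST hT (mem_partsUnion.2 hu) (mem_partsUnion.2 hv) huv (Or.inr hsq)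
    · exact h.hasPST hT (mem_partsUnion.2 hu) (mem_partsUnion.2 hv) huv hq hne
    · obtain ⟨C, -, hC⟩ := h.exists_isTightlySedentary hT.ge (mem_partsUnion.2 hu) hq heq
      exact ⟨C, hC⟩
  · intro hc u hu
    have hT : (partsUnion N I).card = I.card := by
      rw [card_partsUnion, card_partsUnion_singletons hI1]
    have huT : u ∈ partsUnion N I := mem_partsUnion.2 hu
    refine ⟨fun t => ?_, fun m hI' hm Δ hΔ => ?_⟩
    · have := (isTwinSet_singletons hI hI1).le_norm_transition huT t
      rwa [hT] at this
    · have h := isTwoPhaseWalk_singletons hN hI hI1 hI' hm hn hΔ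
      rw [← hT] at hc ⊢
      refine ⟨fun q hq => ⟨fun hne g hg j hj hj0 => ?_, fun heq => ?_⟩, fun hsq => ?_⟩
      · exact h.isTightlySedentaryAt hc huT hq hne hg hj hj0
      · exact h.exists_isTightlySedentary (by omega) huT hq heq
      · exact h.isSharplySedentary hc huT (Or.inr hsq)
  · intro hIn h2 Δ hΔ
    -- `Δ` is never a square here, which settles the claims about a square `Δ`
    have hsq : ∀ q : ℕ, Δ ≠ (q : ℤ) ^ 2 := fun q hq =>
      discr_ne_sq hI.card_pos hIn (hΔ ▸ hq)
    have hnot : ∀ u : Σ ℓ : Fin k, Fin (N ℓ), N u.1 = 2 → u.1 ∉ I := by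
      intro u hu huI
      have := hI1 _ huI
      omega
    refine ⟨fun hns u v hu huv hne => ⟨fun hP => ?_, fun hn3 => ?_⟩,
      fun q hq => absurd hq (hsq q), fun hor u hu => ?_⟩
    · by_contra hn3
      exact not_hasPGST_pair hN hI hI1 h2 hn hIn hΔ hn3 (huv ▸ hnot u hu) huv hne hP
    · exact hasPGST_pair hN hI hI1 h2 hn hIn hΔ hn3 hns (huv ▸ hnot u hu) huv hne
    · rcases hor with ⟨-, hn3⟩ | ⟨q, hq, -⟩
      · obtain ⟨δ, hδ, h⟩ :=
          exists_pos_le_norm_transition_pair hN hI hI1 h2 hn hIn hΔ hn3 (hnot u hu)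
        exact ⟨δ, isCSedentary_of_forall_le hδ fun t => (h t).1⟩
      · exact absurd hq (hsq q)
  · intro u v hu htw m hm
    have huv := isTwin_same_part hu.ge htw
    have huT : u ∈ partsUnion N {u.1} := by simp [mem_partsUnion]
    have hvT : v ∈ partsUnion N {u.1} := by simp [mem_partsUnion, huv]
    have hT : (partsUnion N {u.1}).card = 2 := by
      rw [card_partsUnion, Finset.sum_singleton, hu]
    refine ⟨fun Δ hΔ => ?_, fun hmn s hs hnu g d₁ s₁ hg hd₁ hs₁ => ?_⟩
    · have h := isTwoPhaseWalk_part hN hk u.1 hm hn (Δ := Δ) (by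
        rw [hΔ, hu]; push_cast; ring)
      rw [show (n : ℤ) - N u.1 - m = n - m - 2 by rw [hu]; push_cast; ring] at h
      have hzero : n = m + 2 → (n : ℤ) - m - 2 = 0 := fun h => by omega
      refine ⟨?_, fun hsq => h.hasPGST hT huT hvT htw.1 (Or.inr hsq), ?_⟩
      · rintro (hsq | ⟨q, hq, hne⟩ | hb)
        · exact h.isNotSedentary hT huT (Or.inr hsq)
        · exact h.isNotSedentary_of_nu2_ne hT huT hq hne
        · exact h.isNotSedentary hT huT (Or.inl (hzero hb))
      · rintro (⟨q, hq, hne⟩ | hb)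
        · exact h.hasPST hT huT hvT htw.1 hq hne
        · exact h.hasPST_of_eq_zero hT huT hvT htw.1 (hzero hb)
    · have hb0 : 0 < (n : ℤ) - m - 2 := by omega
      have hg0 : 0 < g := by
        rw [hg]; exact Int.gcd_pos_iff.2 (Or.inl hb0.ne')
      have hg0' : (0 : ℤ) < g := by exact_mod_cast hg0
      have hd0 : 0 < d₁ := by
        rw [hd₁] at hb0
        exact (mul_pos_iff_of_pos_left hg0').1 hb0
      refine ⟨fun h1 t => ?_, fun h2 => ?_⟩
      · rw [h1, mul_one] at hs₁
        have hodd : Odd d₁ := odd_of_nu2_mul_le hg0'.ne' (by rwa [hd₁, hs₁] at hnu)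
        have hgr : (0 : ℝ) < g := by exact_mod_cast hg0
        rw [norm_transition_pair_eq hN hn hu hm hg0 hd0 hd₁ (by rw [hs, hs₁]) t]
        obtain ⟨hlow, hiff⟩ := norm_half_add_phaseMix hodd hd0 (g * t)
        refine ⟨hlow, hiff.trans (exists_congr fun j => and_congr_right fun _ => ?_)⟩
        rw [eq_div_iff hgr.ne', mul_comm]
      · -- `s` divides `n - m - 2`, hence `g = s`, contradicting `2 ≤ s₁`
        exfalso
        have hcard := card_eq_of_equal_parts hn hm
        rw [hu] at hcard
        push_cast at hcard
        have hs2 : 2 ≤ s := by rw [hs₁]; nlinarith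
        have hm0 : (0 : ℤ) ≤ m := Int.natCast_nonneg m
        have hb : (n : ℤ) - m - 2 = ((k : ℤ) - 2) * m := by rw [hcard]; ring
        rw [hb] at hb0
        have hm1 : (1 : ℤ) ≤ m := by
          rcases hm0.eq_or_lt with h0 | h0
          · rw [← h0, mul_zero] at hb0; exact absurd hb0 (lt_irrefl 0)
          · exact h0
        have hc1 : (1 : ℤ) ≤ (k : ℤ) - 2 := by
          by_contra hc
          nlinarith
        have hdvd : s ∣ (n : ℤ) - m - 2 := by
          rw [hb]
          refine dvd_of_root hc1 hm1 hs2 ?_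
          rw [← hb, ← hs, hcard]; ring
        have hsg : s ∣ (g : ℤ) := by rw [hg]; exact Int.dvd_coe_gcd hdvd dvd_rfl
        have := Int.le_of_dvd hg0' hsg
        rw [hs₁] at this
        nlinarith
  · intro u hu
    have huT : u ∈ partsUnion N {u.1} := by simp [mem_partsUnion]
    have hT : (partsUnion N {u.1}).card = N u.1 := by
      rw [card_partsUnion, Finset.sum_singleton]
    refine ⟨fun t => ?_, fun m hm Δ hΔ q hq hne g hg j hj hj0 => ?_, fun hind => ?_⟩
    · have := (isTwinSet_part hN u.1).le_norm_transition huT t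
      rwa [hT] at this
    · have h := isTwoPhaseWalk_part hN hk u.1 hm hn hΔ
      have := h.isTightlySedentaryAt (by omega) huT hq hne hg hj hj0
      rwa [hT] at this
    · exact isSharplySedentary_of_linearIndepOn hN hk hu hind
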